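/- Let $N\ge 1$ be an integer, $1<p<\infty$ and $\gamma\in\mathbb R$. For a measurable set $E\subset\mathbb R^N\times\mathbb R^N$ put $$\nu_\gamma(E)=\iint_{(x,y)\in E,\ x\ne y}|x-y|^{\gamma-N}\,dx\,dy .$$ For a measurable $u:\mathbb R^N\to\mathbb R$, $b\in\mathbb R$ and $x\neq y$ put $Q_bu(x,y)=\dfrac{u(x)-u(y)}{|x-y|^{1+b}}$, and for a measurable function $F$ on $\mathbb R^N\times\mathbb R^N$ put $$[F]_{L^{p,\infty}(\nu_\gamma)}=\sup_{\lambda>0}\lambda\,\nu_\gamma\big(\{|F|>\lambda\}\big)^{1/p}\in[0,\infty];$$ $F\in L^{p,\infty}(\nu_\gamma)$ means that this quantity is finite. Let $\dot W^{1,p}(\mathbb R^N)$ be the space of all $u\in L^1_{\mathrm{loc}}(\mathbb R^N)$ whose distributional gradient $\nabla u$ belongs to $L^p(\mathbb R^N)$. Then the following hold. (i) There is a constant $C=C(N,p,\gamma)<\infty$ such that $$[Q_{\gamma/p}u]_{L^{p,\infty}(\nu_\gamma)}\le C\,\|\nabla u\|_{L^p(\mathbb R^N)}$$ for all $u\in C_c^\infty(\mathbb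 R^N)$ if and only if $\gamma\ne0$. If $\gamma\neq 0$, then this inequality, with a constant $C$ depending only on $N,p,\gamma$, extends to all $u\in\dot W^{1,p}(\mathbb R^N)$. (ii) There is a constant $C=C(N,p,\gamma)<\infty$ (for every real $\gamma$, including $\gamma=0$) such that, whenever $u\in L^1_{\mathrm{loc}}(\mathbb R^N)$ and $Q_{\gamma/p}u\in L^{p,\infty}(\nu_\gamma)$, one has $u\in\dot W^{1,p}(\mathbb R^N)$ and $$\|\nabla u\|_{L^p(\mathbb R^N)}\le C\,[Q_{\gamma/p}u]_{L^{p,\infty}(\nu_\gamma)} .$$ -/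

import Mathlib

open MeasureTheory
open scoped ENNReal NNReal ContDiff

noncomputable section

/-- The measure `dν_γ(x,y) = |x - y|^(γ - N) dx dy` on `{(x, y) ∈ ℝ^N × ℝ^N : x ≠ y}`. -/
def nuMeasure (N : ℕ) (γ : ℝ) :
    Measure (EuclideanSpace ℝ (Fin N) × EuclideanSpace ℝ (Fin N)) :=
  (volume.restrict {z : EuclideanSpace ℝ (Fin N) × EuclideanSpace ℝ (Fin N) |
    z.1 ≠ z.2}).withDensity (fun z => ENNReal.ofReal (‖z.1 - z.2‖ ^ (γ - (N : ℝ))))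

/-- The difference quotient `Q_b u(x,y) = (u(x) - u(y)) / |x - y|^(1 + b)`.
On the diagonal, which `nuMeasure` does not charge, its value here is `0`. -/
def diffQuot {N : ℕ} (b : ℝ) (u : EuclideanSpace ℝ (Fin N) → ℝ)
    (z : EuclideanSpace ℝ (Fin N) × EuclideanSpace ℝ (Fin N)) : ℝ :=
  (u z.1 - u z.2) / ‖z.1 - z.2‖ ^ (1 + b)

/-- The weak `L^p` quasi-norm `[F]_{L^{p,∞}(μ)} = sup_{t > 0} t μ({|F| > t})^(1/p)`,
with values in `[0, ∞]`. -/
def weakLpNorm {α : Type*} [MeasurableSpace α] (F : α → ℝ) (p : ℝ) (μ : Measure α) : ℝ≥0∞ :=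
  ⨆ (t : ℝ) (_ : 0 < t), ENNReal.ofReal t * μ {z | t < |F z|} ^ (1 / p)

/-- `g` is a locally integrable representative of the distributional gradient of `u`:
`∫ u ∂_i φ = - ∫ g_i φ` for all real test functions `φ ∈ C_c^∞(ℝ^N)` and all `i`. -/
structure HasWeakGradient {N : ℕ} (u : EuclideanSpace ℝ (Fin N) → ℝ)
    (g : EuclideanSpace ℝ (Fin N) → EuclideanSpace ℝ (Fin N)) : Prop where
  locallyIntegrable : LocallyIntegrable g volume
  integral_eq : ∀ φ : EuclideanSpace ℝ (Fin N) → ℝ, ContDiff ℝ ∞ φ → HasCompactSupport φ →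
    ∀ i : Fin N, ∫ x, u x * fderiv ℝ φ x (EuclideanSpace.single i 1) = - ∫ x, g x i * φ x

/-- The homogeneous Sobolev space: locally integrable functions whose distributional
gradient belongs to `L^p`. -/
def MemHomogeneousSobolev {N : ℕ} (p : ℝ) (u : EuclideanSpace ℝ (Fin N) → ℝ) : Prop :=
  LocallyIntegrable u volume ∧
    ∃ g : EuclideanSpace ℝ (Fin N) → EuclideanSpace ℝ (Fin N),
      HasWeakGradient u g ∧ MemLp g (ENNReal.ofReal p) volume

end

/-!
In the coordinates `(x, h) = (x, y - x)` the measure `ν_γ` is `dx ⊗ |h|^(γ - N) dh`, and its second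
factor scales by `r^γ` under dilations by `r`.

Upper bound: `|v (x + h) - v x| / |h|` is at most the average of `|∇v|` over the segment from `x` to
`x + h`. Such an average exceeds `2t` only where the average of the excess `(|∇v| - t)₊` exceeds
`t`. Applying this at the level `t |h|^(γ/p)` and integrating in `h` first costs an integral of
`|h|^(γ - γ/p - N)` over `{|h|^(γ/p) < c}`, which converges exactly because `γ ≠ 0`.

Lower bound: dilations of `h` do not increase the weak norm and turn the difference quotients of a
`C¹` function into `∇v(x) · h / |h|^(1 + γ/p)`. The superlevel sets of this function in `h` are
cones of infinite measure if `γ = 0`, so that `∇v = 0`, and otherwise their measure is a positive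
multiple of `|∇v(x)|^p`.

General `u` are mollified. The truncation argument above shows that mollifying costs only a constant
in the weak norm, as it averages the difference quotient over diagonal translations. For the
converse, the gradients of the mollifications are bounded in `L^p`; since `L^p` is uniformly convex,
they have a weak limit, which is the gradient of `u`.
-/

open Filter Set Topology Metric
open scoped InnerProductSpace Convolution

section WeakLp

variable {α : Type*} [MeasurableSpace α] {μ : Measure α} {p : ℝ}

theorem weakLpNorm_le_of_forall {F : α → ℝ} (hp : 0 < p) {B : ℝ≥0∞}
    (h : ∀ t : ℝ, 0 < t → ENNReal.ofReal t ^ p * μ {z | t < |F z|} ≤ B ^ p) :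
    weakLpNorm F p μ ≤ B := by
  refine iSup₂_le fun t ht => ?_
  rw [← ENNReal.rpow_le_rpow_iff hp, ENNReal.mul_rpow_of_nonneg _ _ hp.le, ← ENNReal.rpow_mul,
    one_div_mul_cancel hp.ne', ENNReal.rpow_one]
  exact h t ht

theorem ofReal_rpow_mul_le_weakLpNorm_rpow (F : α → ℝ) (hp : 0 < p) {t : ℝ} (ht : 0 < t) :
    ENNReal.ofReal t ^ p * μ {z | t < |F z|} ≤ weakLpNorm F p μ ^ p := by
  have hle : ENNReal.ofReal t * μ {z | t < |F z|} ^ (1 / p) ≤ weakLpNorm F p μ :=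
    le_iSup₂ (f := fun (t : ℝ) (_ : 0 < t) => ENNReal.ofReal t * μ {z | t < |F z|} ^ (1 / p)) t ht
  rwa [← ENNReal.rpow_le_rpow_iff hp, ENNReal.mul_rpow_of_nonneg _ _ hp.le, ← ENNReal.rpow_mul,
    one_div_mul_cancel hp.ne', ENNReal.rpow_one] at hle

theorem measure_lt_le_weakLpNorm_rpow_mul (F : α → ℝ) (hp : 0 < p) {t : ℝ} (ht : 0 < t) :
    μ {z | t < |F z|} ≤ weakLpNorm F p μ ^ p * ENNReal.ofReal (t ^ (-p)) := by
  rw [← ENNReal.ofReal_rpow_of_pos ht, ENNReal.rpow_neg, ← div_eq_mul_inv,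
    ENNReal.le_div_iff_mul_le (.inl (by simp [ht])) (.inl (by simp [hp.le])), mul_comm]
  exact ofReal_rpow_mul_le_weakLpNorm_rpow F hp ht

theorem weakLpNorm_congr_ae {F G : α → ℝ} (h : F =ᵐ[μ] G) :
    weakLpNorm F p μ = weakLpNorm G p μ := by
  have hμ : ∀ t : ℝ, μ {z | t < |F z|} = μ {z | t < |G z|} := fun t =>
    measure_congr (h.mono fun z hz => congrArg (fun a => t < |a|) hz)
  simp only [weakLpNorm, hμ]

theorem weakLpNorm_comp_measurePreserving {β : Type*} [MeasurableSpace β] {ν : Measure β}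
    {e : α → β} (he : MeasurePreserving e μ ν) {F : β → ℝ} (hF : Measurable F) :
    weakLpNorm (F ∘ e) p μ = weakLpNorm F p ν := by
  have hμ : ∀ t : ℝ, μ {z | t < |(F ∘ e) z|} = ν {z | t < |F z|} := fun t =>
    he.measure_preimage (measurableSet_lt measurable_const hF.abs).nullMeasurableSet
  simp only [weakLpNorm, hμ]

theorem weakLpNorm_le_of_ae_tendsto {F : ℕ → α → ℝ} {G : α → ℝ} (hp : 0 < p) {B : ℝ≥0∞}
    (hB : ∀ n, weakLpNorm (F n) p μ ≤ B)
    (hlim : ∀ᵐ z ∂μ, Tendsto (fun n => F n z) atTop (𝓝 (G z))) : weakLpNorm G p μ ≤ B := by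
  refine weakLpNorm_le_of_forall hp fun t ht => ?_
  have hae : ∀ᵐ z ∂μ, z ∈ {z | t < |G z|} → z ∈ ⋃ N, ⋂ n ≥ N, {z | t < |F n z|} := by
    filter_upwards [hlim] with z hz hzt
    simpa only [mem_iUnion, mem_iInter, mem_ofPred_eq, ← eventually_atTop] using
      hz.abs.eventually_const_lt hzt
  have hmono : Monotone fun N => ⋂ n ≥ N, {z | t < |F n z|} := fun N M hNM =>
    biInter_subset_biInter_left fun n hn => le_trans hNM hn
  calc ENNReal.ofReal t ^ p * μ {z | t < |G z|}
      ≤ ENNReal.ofReal t ^ p * ⨆ N, μ (⋂ n ≥ N, {z | t < |F n z|}) := by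
        rw [← hmono.measure_iUnion]
        exact mul_le_mul_right (measure_mono_ae hae) _
    _ = ⨆ N, ENNReal.ofReal t ^ p * μ (⋂ n ≥ N, {z | t < |F n z|}) := ENNReal.mul_iSup _ _
    _ ≤ B ^ p := iSup_le fun N => calc
        _ ≤ ENNReal.ofReal t ^ p * μ {z | t < |F N z|} := by
          gcongr
          exact biInter_subset_of_mem (le_refl N)
        _ ≤ B ^ p := (ofReal_rpow_mul_le_weakLpNorm_rpow _ hp ht).trans (by gcongr; exact hB N)

theorem lintegral_Ioi_add_rpow_neg {p t : ℝ} (hp : 1 < p) (ht : 0 < t) :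
    ∫⁻ s in Ioi (0 : ℝ), ENNReal.ofReal ((s + t) ^ (-p)) =
      ENNReal.ofReal (t ^ (1 - p) / (p - 1)) := by
  have hint := integrableOn_add_rpow_Ioi_of_lt (a := -p) (c := 0) (m := t) (by linarith)
    (by linarith)
  rw [← ofReal_integral_eq_lintegral_ofReal hint (ae_restrict_of_forall_mem measurableSet_Ioi
    fun s hs => Real.rpow_nonneg (add_pos hs ht).le _)]
  have hshift := (measurePreserving_add_right volume t).setIntegral_preimage_emb
    (measurableEmbedding_addRight t) (fun s => s ^ (-p)) (Ioi t)
  rw [preimage_add_const_Ioi, sub_self] at hshift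
  rw [hshift, integral_Ioi_rpow_of_lt (by linarith) ht, neg_add_eq_sub,
    ← neg_sub p 1, neg_div_neg_eq]

/-- Since `∫ (|F| - t)₊ = ∫_t^∞ μ {r < |F|} dr`, only the levels above `t` enter. -/
theorem lintegral_tsub_le_weakLpNorm_rpow_mul (hp : 1 < p) {F : α → ℝ} (hF : Measurable F) {t : ℝ}
    (ht : 0 < t) : ∫⁻ z, (‖F z‖ₑ - ENNReal.ofReal t) ∂μ ≤
      weakLpNorm F p μ ^ p * ENNReal.ofReal (t ^ (1 - p) / (p - 1)) := by
  have hpos : ∀ z, ‖F z‖ₑ - ENNReal.ofReal t = ENNReal.ofReal (max (|F z| - t) 0) := fun z => by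
    rw [Real.enorm_eq_ofReal_abs, ← ENNReal.ofReal_sub _ ht.le, ENNReal.ofReal_max,
      ENNReal.ofReal_zero, max_eq_left zero_le]
  simp_rw [hpos]
  rw [lintegral_eq_lintegral_meas_lt (f := fun z => max (|F z| - t) 0) μ
      (ae_of_all _ fun z => le_max_right _ _)
    (by fun_prop), ← lintegral_Ioi_add_rpow_neg hp ht, ← lintegral_const_mul _ (by fun_prop)]
  refine setLIntegral_mono' measurableSet_Ioi fun s (hs : 0 < s) => ?_
  refine (measure_mono fun z (hz : s < max (|F z| - t) 0) => ?_).trans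
    (measure_lt_le_weakLpNorm_rpow_mul F (by linarith) (add_pos hs ht))
  have := (lt_max_iff.1 hz).resolve_right hs.not_gt
  exact lt_sub_iff_add_lt.1 this

end WeakLp

section TruncatedMarkov

variable {α β : Type*} [MeasurableSpace α] [MeasurableSpace β] {μ : Measure α} [SFinite μ]
  {ρ : Measure β} [IsProbabilityMeasure ρ]

/-- As `g ≤ t + (g - t)`, the average of `g` can only exceed `2 * t` where the average of the
excess `g - t` exceeds `t`. -/
theorem mul_measure_lt_lintegral_comp_le {T : β → α → α} (hT : Measurable (Function.uncurry T))
    (hTμ : ∀ s, MeasurePreserving (T s) μ μ) {g : α → ℝ≥0∞} (hg : Measurable g) (t : ℝ≥0∞) :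
    t * μ {x | 2 * t < ∫⁻ s, g (T s x) ∂ρ} ≤ ∫⁻ x, (g x - t) ∂μ := by
  have hexcess : Measurable fun q : α × β => g (T q.2 q.1) - t :=
    (hg.comp (hT.comp measurable_swap)).sub_const t
  have hsub : {x | 2 * t < ∫⁻ s, g (T s x) ∂ρ} ⊆ {x | t ≤ ∫⁻ s, (g (T s x) - t) ∂ρ} := by
    intro x (hx : 2 * t < _)
    have hle : ∫⁻ s, g (T s x) ∂ρ ≤ t + ∫⁻ s, (g (T s x) - t) ∂ρ := calc
      ∫⁻ s, g (T s x) ∂ρ ≤ ∫⁻ s, (t + (g (T s x) - t)) ∂ρ := lintegral_mono fun s => le_add_tsub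
      _ = t + ∫⁻ s, (g (T s x) - t) ∂ρ := by
        rw [lintegral_add_left measurable_const, lintegral_const, measure_univ, mul_one]
    rw [two_mul] at hx
    exact (lt_of_add_lt_add_left (hx.trans_le hle)).le
  calc t * μ {x | 2 * t < ∫⁻ s, g (T s x) ∂ρ}
      ≤ t * μ {x | t ≤ ∫⁻ s, (g (T s x) - t) ∂ρ} := by gcongr
    _ ≤ ∫⁻ x, ∫⁻ s, (g (T s x) - t) ∂ρ ∂μ :=
        mul_meas_ge_le_lintegral hexcess.lintegral_prod_right' t
    _ = ∫⁻ s, ∫⁻ x, (g (T s x) - t) ∂μ ∂ρ := lintegral_lintegral_swap hexcess.aemeasurable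
    _ = ∫⁻ x, (g x - t) ∂μ := by
        simp_rw [fun s => (hTμ s).lintegral_comp (hg.sub_const t)]
        rw [lintegral_const, measure_univ, mul_one]

theorem weakLpNorm_le_of_enorm_le_lintegral {p : ℝ} (hp : 1 < p) {T : β → α → α}
    (hT : Measurable (Function.uncurry T)) (hTμ : ∀ s, MeasurePreserving (T s) μ μ)
    {F G : α → ℝ} (hF : Measurable F) (hG : ∀ z, ‖G z‖ₑ ≤ ∫⁻ s, ‖F (T s z)‖ₑ ∂ρ) :
    weakLpNorm G p μ ≤ ENNReal.ofReal (2 ^ p / (p - 1)) ^ (1 / p) * weakLpNorm F p μ := by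
  have hp0 : 0 < p := one_pos.trans hp
  refine weakLpNorm_le_of_forall hp0 fun t ht => ?_
  have hsub : {z | t < |G z|} ⊆ {z | 2 * ENNReal.ofReal (t / 2) < ∫⁻ s, ‖F (T s z)‖ₑ ∂ρ} := by
    intro z (hz : t < |G z|)
    refine lt_of_lt_of_le ?_ (hG z)
    rwa [← ENNReal.ofReal_ofNat, ← ENNReal.ofReal_mul zero_le_two, mul_div_cancel₀ _ two_ne_zero,
      Real.enorm_eq_ofReal_abs, ENNReal.ofReal_lt_ofReal_iff (ht.trans hz)]
  have htail : ENNReal.ofReal (t / 2) * μ {z | t < |G z|} ≤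
      weakLpNorm F p μ ^ p * ENNReal.ofReal ((t / 2) ^ (1 - p) / (p - 1)) :=
    (mul_le_mul_right (measure_mono hsub) _).trans <|
      (mul_measure_lt_lintegral_comp_le hT hTμ hF.enorm _).trans
        (lintegral_tsub_le_weakLpNorm_rpow_mul hp hF (half_pos ht))
  have hsplit : t ^ p = 2 ^ p * (t / 2) ^ (p - 1) * (t / 2) := by
    rw [mul_assoc, Real.rpow_sub_one (half_pos ht).ne', div_mul_cancel₀ _ (half_pos ht).ne',
      ← Real.mul_rpow zero_le_two (half_pos ht).le, mul_div_cancel₀ _ two_ne_zero]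
  calc ENNReal.ofReal t ^ p * μ {z | t < |G z|}
      = ENNReal.ofReal (2 ^ p * (t / 2) ^ (p - 1)) *
          (ENNReal.ofReal (t / 2) * μ {z | t < |G z|}) := by
        rw [ENNReal.ofReal_rpow_of_pos ht, hsplit, ENNReal.ofReal_mul (by positivity), mul_assoc]
    _ ≤ ENNReal.ofReal (2 ^ p * (t / 2) ^ (p - 1)) *
          (weakLpNorm F p μ ^ p * ENNReal.ofReal ((t / 2) ^ (1 - p) / (p - 1))) := by gcongr
    _ = (ENNReal.ofReal (2 ^ p / (p - 1)) ^ (1 / p) * weakLpNorm F p μ) ^ p := by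
        rw [mul_left_comm, ← ENNReal.ofReal_mul (by positivity),
          ENNReal.mul_rpow_of_nonneg _ _ hp0.le, ← ENNReal.rpow_mul,
          one_div_mul_cancel hp0.ne', ENNReal.rpow_one, mul_comm, mul_assoc, ← mul_div_assoc,
          ← Real.rpow_add (half_pos ht), sub_add_sub_cancel, sub_self, Real.rpow_zero,
          mul_one_div]

end TruncatedMarkov

section RadialMeasure

variable {E : Type*} [NormedAddCommGroup E] [InnerProductSpace ℝ E] [FiniteDimensional ℝ E]
  [MeasurableSpace E] [BorelSpace E] {γ : ℝ}

variable (E γ) in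
/-- The measure `‖h‖ ^ (γ - d) dh` on the nonzero vectors of a `d`-dimensional Euclidean space,
homogeneous of degree `γ` under dilations: it is the law of the increment `y - x` under
`nuMeasure`. -/
noncomputable def radialMeasure : Measure E :=
  (volume.restrict {0}ᶜ).withDensity fun h =>
    ENNReal.ofReal (‖h‖ ^ (γ - Module.finrank ℝ E))

instance : SFinite (radialMeasure E γ) := by
  unfold radialMeasure
  infer_instance

theorem lintegral_radialMeasure {f : E → ℝ≥0∞} (hf : Measurable f) :
    ∫⁻ h, f h ∂radialMeasure E γ =
      ∫⁻ h in {0}ᶜ, ENNReal.ofReal (‖h‖ ^ (γ - Module.finrank ℝ E)) * f h := by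
  rw [radialMeasure, lintegral_withDensity_eq_lintegral_mul _ (by fun_prop) hf]
  rfl

theorem ae_radialMeasure_ne_zero : ∀ᵐ h ∂radialMeasure E γ, h ≠ 0 :=
  (withDensity_absolutelyContinuous _ _).ae_le
    (ae_restrict_mem (measurableSet_singleton 0).compl)

theorem map_smul_radialMeasure {r : ℝ} (hr : 0 < r) :
    (radialMeasure E γ).map (r • ·) = ENNReal.ofReal (r ^ (-γ)) • radialMeasure E γ := by
  set d := Module.finrank ℝ E
  refine Measure.ext_of_lintegral _ fun f hf => ?_
  set w : E → ℝ≥0∞ :=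
    ({0}ᶜ : Set E).indicator fun h => ENNReal.ofReal (‖h‖ ^ (γ - d)) * f h with hw
  have hwm : Measurable w := Measurable.indicator (by fun_prop) (measurableSet_singleton 0).compl
  have hwr : ∀ h, ({0}ᶜ : Set E).indicator
      (fun h => ENNReal.ofReal (‖h‖ ^ (γ - d)) * f (r • h)) h =
        ENNReal.ofReal (r ^ (d - γ)) * w (r • h) := fun h => by
    by_cases hh : h = 0
    · simp [hw, hh]
    · rw [hw, indicator_of_mem hh, indicator_of_mem (smul_ne_zero hr.ne' hh), ← mul_assoc,
        ← ENNReal.ofReal_mul (by positivity), norm_smul, Real.norm_of_nonneg hr.le,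
        Real.mul_rpow hr.le (norm_nonneg h), ← mul_assoc, ← Real.rpow_add hr]
      simp
  rw [lintegral_map hf (by fun_prop), lintegral_smul_measure, lintegral_radialMeasure (by fun_prop),
    lintegral_radialMeasure hf, ← lintegral_indicator (measurableSet_singleton 0).compl,
    ← lintegral_indicator (measurableSet_singleton 0).compl]
  rw [lintegral_congr hwr]
  rw [lintegral_const_mul _ (by fun_prop), ← lintegral_map hwm (by fun_prop),
    Measure.map_addHaar_smul _ hr.ne', lintegral_smul_measure, smul_eq_mul, smul_eq_mul,
    ← mul_assoc, ← ENNReal.ofReal_mul (by positivity), abs_of_pos (by positivity),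
    ← Real.rpow_natCast, ← Real.rpow_neg hr.le, ← Real.rpow_add hr]
  congr 3
  ring

theorem radialMeasure_preimage_smul {r : ℝ} (hr : 0 < r) (S : Set E) :
    radialMeasure E γ ((r • ·) ⁻¹' S) = ENNReal.ofReal (r ^ (-γ)) * radialMeasure E γ S := by
  rw [← (measurableEmbedding_const_smul₀ hr.ne').map_apply, map_smul_radialMeasure hr]
  rfl

theorem measurePreserving_radialMeasure (e : E ≃ₗᵢ[ℝ] E) :
    MeasurePreserving e (radialMeasure E γ) (radialMeasure E γ) := by
  refine ⟨e.continuous.measurable, Measure.ext_of_lintegral _ fun f hf => ?_⟩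
  have hpre : e ⁻¹' {0}ᶜ = {0}ᶜ := by ext h; simp
  rw [lintegral_map hf e.continuous.measurable,
    lintegral_radialMeasure (f := fun h => f (e h)) (hf.comp e.continuous.measurable),
    lintegral_radialMeasure hf]
  have := e.measurePreserving.setLIntegral_comp_preimage_emb
    e.toHomeomorph.measurableEmbedding
    (fun h => ENNReal.ofReal (‖h‖ ^ (γ - Module.finrank ℝ E)) * f h) {0}ᶜ
  simpa only [hpre, e.norm_map] using this

theorem radialMeasure_pos {U : Set E} (hU : IsOpen U) (hne : U.Nonempty) (h0 : (0 : E) ∉ U) :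
    0 < radialMeasure E γ U := by
  refine pos_iff_ne_zero.2 fun h => ?_
  have hU0 : U ⊆ {h | ENNReal.ofReal (‖h‖ ^ (γ - Module.finrank ℝ E)) ≠ 0} := fun h hh =>
    (ENNReal.ofReal_pos.2 (Real.rpow_pos_of_pos (norm_pos_iff.2 fun h' => h0 (h' ▸ hh)) _)).ne'
  rw [radialMeasure, withDensity_apply_eq_zero (by fun_prop), inter_eq_right.2 hU0,
    Measure.restrict_apply hU.measurableSet,
    inter_eq_left.2 (subset_compl_singleton_iff.2 h0)] at h
  exact (hU.measure_pos volume hne).ne' h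

theorem integrableOn_rpow_sub_one_of_rpow_lt_one {β q : ℝ} (hβ : β ≠ 0) (hq : 0 < q) :
    IntegrableOn (fun y : ℝ => y ^ (β * q - 1)) (Ioi 0 ∩ {y | y ^ β < 1}) := by
  have hlt : ∀ y : ℝ, 0 < y → (y ^ β < 1 ↔ 1 < y ∧ β < 0 ∨ y < 1 ∧ 0 < β) := fun y hy =>
    Real.rpow_lt_one_iff_of_pos hy
  rcases hβ.lt_or_gt with hβ | hβ
  · refine (integrableOn_Ioi_rpow_of_lt (by nlinarith) one_pos).mono_set fun y ⟨hy, hyβ⟩ => ?_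
    exact (((hlt y hy).1 hyβ).resolve_right fun h => hβ.not_gt h.2).1
  · refine ((intervalIntegral.integrableOn_Ioo_rpow_iff one_pos).2
      (by nlinarith)).mono_set fun y ⟨hy, hyβ⟩ => ⟨hy, ?_⟩
    exact (((hlt y hy).1 hyβ).resolve_left fun h => hβ.not_gt h.2).1

theorem radialMeasure_norm_rpow_lt_one_ne_top [Nontrivial E] {β q : ℝ} (hβ : β ≠ 0) (hq : 0 < q) :
    radialMeasure E (β * q) {h | ‖h‖ ^ β < 1} ≠ ⊤ := by
  set d := Module.finrank ℝ E
  set f : ℝ → ℝ := indicator {y | y ^ β < 1} fun y => y ^ (β * q - d)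
  have hS : MeasurableSet {h : E | ‖h‖ ^ β < 1} :=
    measurableSet_lt (by fun_prop) measurable_const
  have hpow : ∀ y ∈ Ioi (0 : ℝ), y ^ (d - 1) • f y =
      indicator {y | y ^ β < 1} (fun y => y ^ (β * q - 1)) y := fun y (hy : 0 < y) => by
    by_cases hyβ : y ^ β < 1
    · simp only [f, indicator_of_mem (show y ∈ {y | y ^ β < 1} from hyβ), smul_eq_mul]
      rw [← Real.rpow_natCast, ← Real.rpow_add hy, Nat.cast_sub Module.finrank_pos, Nat.cast_one]
      congr 1
      ring
    · simp only [f, indicator_of_notMem (show y ∉ {y | y ^ β < 1} from hyβ), smul_zero]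
  have hf : Integrable (fun h : E => f ‖h‖) := by
    rw [integrable_fun_norm_addHaar, integrableOn_congr_fun hpow measurableSet_Ioi,
      integrableOn_indicator_iff (measurableSet_lt (by fun_prop) measurable_const), inter_comm]
    exact integrableOn_rpow_sub_one_of_rpow_lt_one hβ hq
  refine ne_top_of_le_ne_top hf.lintegral_lt_top.ne ?_
  rw [radialMeasure, withDensity_apply _ hS]
  calc ∫⁻ h in {h | ‖h‖ ^ β < 1}, ENNReal.ofReal (‖h‖ ^ (β * q - d)) ∂volume.restrict {0}ᶜ
      ≤ ∫⁻ h in {h : E | ‖h‖ ^ β < 1}, ENNReal.ofReal (‖h‖ ^ (β * q - d)) :=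
        lintegral_mono' (Measure.restrict_mono le_rfl Measure.restrict_le_self) le_rfl
    _ = ∫⁻ h in {h : E | ‖h‖ ^ β < 1}, ENNReal.ofReal (f ‖h‖) :=
        setLIntegral_congr_fun hS fun h hh => by
          simp only [f, indicator_of_mem (show ‖h‖ ∈ {y : ℝ | y ^ β < 1} from hh)]
    _ ≤ ∫⁻ h : E, ENNReal.ofReal (f ‖h‖) := setLIntegral_le_lintegral _ _

theorem radialMeasure_norm_rpow_lt {β q b : ℝ} (hβ : β ≠ 0) (hq : 0 < q) (hb : 0 ≤ b) :
    radialMeasure E (β * q) {h | ‖h‖ ^ β < b} =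
      ENNReal.ofReal b ^ q * radialMeasure E (β * q) {h | ‖h‖ ^ β < 1} := by
  rcases hb.eq_or_lt with rfl | hb
  · have : {h : E | ‖h‖ ^ β < 0} = ∅ := eq_empty_of_forall_notMem fun h hh =>
      (Real.rpow_nonneg (norm_nonneg h) β).not_gt hh
    simp [this, hq]
  have hr : 0 < b ^ (-β⁻¹) := Real.rpow_pos_of_pos hb _
  have hpre : {h : E | ‖h‖ ^ β < b} = (b ^ (-β⁻¹) • ·) ⁻¹' {h : E | ‖h‖ ^ β < 1} := by
    ext h
    simp only [mem_ofPred_eq, mem_preimage]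
    rw [norm_smul, Real.norm_of_nonneg hr.le, Real.mul_rpow hr.le (norm_nonneg h),
      ← Real.rpow_mul hb.le, neg_mul, inv_mul_cancel₀ hβ, Real.rpow_neg_one, inv_mul_lt_iff₀ hb,
      mul_one]
  rw [hpre, radialMeasure_preimage_smul hr, ← Real.rpow_mul hb.le, ENNReal.ofReal_rpow_of_pos hb]
  congr 3
  field_simp

end RadialMeasure

theorem enorm_sub_le_mul_lintegral_fderiv {E F : Type*} [NormedAddCommGroup E] [NormedSpace ℝ E]
    [NormedAddCommGroup F] [NormedSpace ℝ F] {v : E → F} (hv : ContDiff ℝ 1 v) (x h : E) :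
    ‖v (x + h) - v x‖ₑ ≤ (∫⁻ τ in Icc (0 : ℝ) 1, ‖fderiv ℝ v (x + τ • h)‖ₑ) * ‖h‖ₑ := by
  have hderiv : ∀ τ : ℝ, HasDerivAt (fun τ : ℝ => v (x + τ • h)) (fderiv ℝ v (x + τ • h) h) τ :=
    fun τ => by
      have hline : HasDerivAt (fun τ : ℝ => x + τ • h) h τ := by
        simpa using ((hasDerivAt_id τ).smul_const h).const_add x
      exact ((hv.differentiable one_ne_zero _).hasFDerivAt).comp_hasDerivAt τ hline
  have hsub := enorm_sub_le_lintegral_deriv_of_contDiffOn_Icc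
    (f := fun τ : ℝ => v (x + τ • h)) (by fun_prop : ContDiff ℝ 1 _).contDiffOn zero_le_one
  rw [one_smul, zero_smul, add_zero] at hsub
  have hm : Measurable fun τ : ℝ => ‖fderiv ℝ v (x + τ • h)‖ₑ :=
    ((hv.continuous_fderiv one_ne_zero).comp (by fun_prop)).enorm.measurable
  rw [← lintegral_mul_const _ hm]
  refine hsub.trans (lintegral_mono fun τ => ?_)
  rw [(hderiv τ).deriv]
  exact (fderiv ℝ v (x + τ • h)).le_opENorm h

section IncrementQuotient

variable {E : Type*} [NormedAddCommGroup E]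

/-- The difference quotient `(v (x + h) - v x) / ‖h‖ ^ (1 + b)` in the coordinates `(x, h)`, where
`h` is the increment. -/
noncomputable def incrementQuot (b : ℝ) (v : E → ℝ) (q : E × E) : ℝ :=
  (v (q.1 + q.2) - v q.1) / ‖q.2‖ ^ (1 + b)

theorem lt_abs_incrementQuot_iff {b t : ℝ} {v : E → ℝ} {x h : E} (hh : h ≠ 0) :
    t < |incrementQuot b v (x, h)| ↔ t * ‖h‖ ^ b * ‖h‖ < |v (x + h) - v x| := by
  have hpos : 0 < ‖h‖ := norm_pos_iff.2 hh
  rw [incrementQuot, abs_div, abs_of_pos (Real.rpow_pos_of_pos hpos _),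
    lt_div_iff₀ (Real.rpow_pos_of_pos hpos _), Real.rpow_add hpos, Real.rpow_one, mul_assoc,
    mul_comm ‖h‖]

variable [MeasurableSpace E] [BorelSpace E]

theorem measurable_incrementQuot [SecondCountableTopology E] (b : ℝ) {v : E → ℝ}
    (hv : Measurable v) :
    Measurable (incrementQuot b v) := by
  unfold incrementQuot
  fun_prop

variable [InnerProductSpace ℝ E] [FiniteDimensional ℝ E]

theorem mul_volume_lt_increment_le {v : E → ℝ} (hv : ContDiff ℝ 1 v) (h : E) {t : ℝ}
    (ht : 0 ≤ t) :
    ENNReal.ofReal t * volume {x | 2 * t * ‖h‖ < |v (x + h) - v x|} ≤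
      ∫⁻ x, (‖fderiv ℝ v x‖ₑ - ENNReal.ofReal t) := by
  have : IsProbabilityMeasure (volume.restrict (Icc (0 : ℝ) 1)) := ⟨by simp⟩
  refine le_trans ?_ (mul_measure_lt_lintegral_comp_le (ρ := volume.restrict (Icc (0 : ℝ) 1))
    (T := fun τ x => x + τ • h) (by fun_prop) (fun τ => measurePreserving_add_right volume (τ • h))
    (hv.continuous_fderiv one_ne_zero).enorm.measurable _)
  gcongr with x
  intro hx
  have hlt : 2 * ENNReal.ofReal t * ‖h‖ₑ < ‖v (x + h) - v x‖ₑ := by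
    rw [Real.enorm_eq_ofReal_abs, ← ofReal_norm, ← ENNReal.ofReal_ofNat,
      ← ENNReal.ofReal_mul zero_le_two, ← ENNReal.ofReal_mul' (norm_nonneg h)]
    exact (ENNReal.ofReal_lt_ofReal_iff_of_nonneg (by positivity)).2 hx
  exact lt_of_mul_lt_mul_right (hlt.trans_le (enorm_sub_le_mul_lintegral_fderiv hv x h)) zero_le

theorem lintegral_norm_rpow_mul_radialMeasure {γ a : ℝ} {f : E → ℝ≥0∞} (hf : Measurable f) :
    ∫⁻ h, ENNReal.ofReal (‖h‖ ^ a) * f h ∂radialMeasure E γ =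
      ∫⁻ h, f h ∂radialMeasure E (γ + a) := by
  rw [lintegral_radialMeasure (by fun_prop), lintegral_radialMeasure hf]
  refine setLIntegral_congr_fun (measurableSet_singleton 0).compl fun h hh => ?_
  have hpos : 0 < ‖h‖ := norm_pos_iff.2 hh
  rw [← mul_assoc, ← ENNReal.ofReal_mul (by positivity), ← Real.rpow_add hpos]
  congr 3
  ring

theorem lintegral_inv_mul_tsub_radialMeasure_le {β p s A : ℝ} (hβ : β ≠ 0) (hp : 1 < p)
    (hs : 0 < s) (hA : 0 ≤ A) :
    ∫⁻ h, (ENNReal.ofReal (s * ‖h‖ ^ β))⁻¹ * (ENNReal.ofReal A - ENNReal.ofReal (s * ‖h‖ ^ β))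
        ∂radialMeasure E (β * p) ≤
      ENNReal.ofReal (A / s) ^ p * radialMeasure E (β * (p - 1)) {h | ‖h‖ ^ β < 1} := by
  have hmeas : MeasurableSet {h : E | ‖h‖ ^ β < A / s} :=
    measurableSet_lt (by fun_prop) measurable_const
  calc _ ≤ ∫⁻ h, ENNReal.ofReal (A / s) * (ENNReal.ofReal (‖h‖ ^ (-β)) *
          {h : E | ‖h‖ ^ β < A / s}.indicator 1 h) ∂radialMeasure E (β * p) := by
        refine lintegral_mono_ae (ae_radialMeasure_ne_zero.mono fun h hh => ?_)
        have hpos : 0 < ‖h‖ := norm_pos_iff.2 hh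
        by_cases hlt : ‖h‖ ^ β < A / s
        · rw [indicator_of_mem (show h ∈ {h : E | ‖h‖ ^ β < A / s} from hlt), Pi.one_apply, mul_one,
            ← ENNReal.ofReal_inv_of_pos (by positivity), ← ENNReal.ofReal_mul (by positivity)]
          refine (mul_le_mul_right tsub_le_self _).trans_eq ?_
          rw [← ENNReal.ofReal_mul (by positivity), Real.rpow_neg hpos.le]
          congr 1
          field_simp
        · rw [tsub_eq_zero_of_le, mul_zero]
          · exact zero_le
          · refine ENNReal.ofReal_le_ofReal ?_
            rwa [not_lt, div_le_iff₀' hs] at hlt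
    _ = ENNReal.ofReal (A / s) * radialMeasure E (β * (p - 1)) {h | ‖h‖ ^ β < A / s} := by
        rw [lintegral_const_mul _ (by fun_prop), lintegral_norm_rpow_mul_radialMeasure
          (measurable_one.indicator hmeas), lintegral_indicator_one hmeas]
        congr 2
        ring_nf
    _ = _ := by
        rw [radialMeasure_norm_rpow_lt hβ (by linarith) (by positivity), ← mul_assoc]
        congr 1
        nth_rw 1 [← ENNReal.rpow_one (ENNReal.ofReal (A / s))]
        rw [← ENNReal.rpow_add_of_nonneg _ _ zero_le_one (by linarith), add_sub_cancel]

theorem volume_lt_abs_incrementQuot_le {β s : ℝ} (hs : 0 < s) {v : E → ℝ} (hv : ContDiff ℝ 1 v)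
    {h : E} (hh : h ≠ 0) :
    volume {x | 2 * s < |incrementQuot β v (x, h)|} ≤
      ∫⁻ x, (ENNReal.ofReal (s * ‖h‖ ^ β))⁻¹ *
        (‖fderiv ℝ v x‖ₑ - ENNReal.ofReal (s * ‖h‖ ^ β)) := by
  have hpos : 0 < s * ‖h‖ ^ β := mul_pos hs (Real.rpow_pos_of_pos (norm_pos_iff.2 hh) _)
  have hfderiv : Measurable fun x => ‖fderiv ℝ v x‖ₑ :=
    (hv.continuous_fderiv one_ne_zero).enorm.measurable
  simp only [lt_abs_incrementQuot_iff hh, mul_assoc 2 s]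
  rw [lintegral_const_mul _ (hfderiv.sub_const _), ← ENNReal.div_eq_inv_mul,
    ENNReal.le_div_iff_mul_le (.inl (ENNReal.ofReal_pos.2 hpos).ne') (.inl ENNReal.ofReal_ne_top),
    mul_comm]
  exact mul_volume_lt_increment_le hv h hpos.le

theorem measure_lt_abs_incrementQuot_le {β p s : ℝ} (hβ : β ≠ 0) (hp : 1 < p) (hs : 0 < s)
    {v : E → ℝ} (hv : ContDiff ℝ 1 v) :
    (volume.prod (radialMeasure E (β * p))) {q | 2 * s < |incrementQuot β v q|} ≤
      ∫⁻ x, ENNReal.ofReal (‖fderiv ℝ v x‖ / s) ^ p *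
        radialMeasure E (β * (p - 1)) {h | ‖h‖ ^ β < 1} := by
  let τ : E → ℝ≥0∞ := fun h => ENNReal.ofReal (s * ‖h‖ ^ β)
  have hS : MeasurableSet {q | 2 * s < |incrementQuot β v q|} :=
    measurableSet_lt measurable_const (measurable_incrementQuot β hv.continuous.measurable).abs
  calc _ = ∫⁻ h, volume {x | 2 * s < |incrementQuot β v (x, h)|} ∂radialMeasure E (β * p) :=
        Measure.prod_apply_symm hS
    _ ≤ ∫⁻ h, ∫⁻ x, (τ h)⁻¹ * (‖fderiv ℝ v x‖ₑ - τ h) ∂volume ∂radialMeasure E (β * p) :=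
        lintegral_mono_ae
          (ae_radialMeasure_ne_zero.mono fun _ => volume_lt_abs_incrementQuot_le hs hv)
    _ = ∫⁻ x, ∫⁻ h, (τ h)⁻¹ * (‖fderiv ℝ v x‖ₑ - τ h) ∂radialMeasure E (β * p) ∂volume :=
        lintegral_lintegral_swap (by fun_prop)
    _ ≤ _ := lintegral_mono fun x => by
        rw [← ofReal_norm]
        exact lintegral_inv_mul_tsub_radialMeasure_le hβ hp hs (norm_nonneg _)

theorem ofReal_rpow_mul_measure_lt_incrementQuot_le {β p t : ℝ} (hβ : β ≠ 0) (hp : 1 < p)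
    (ht : 0 < t) {v : E → ℝ} (hv : ContDiff ℝ 1 v) :
    ENNReal.ofReal t ^ p * (volume.prod (radialMeasure E (β * p)))
        {q | t < |incrementQuot β v q|} ≤
      2 ^ p * radialMeasure E (β * (p - 1)) {h | ‖h‖ ^ β < 1} *
        ∫⁻ x, ‖fderiv ℝ v x‖ₑ ^ p := by
  have hp0 : 0 ≤ p := by linarith
  have hbound := measure_lt_abs_incrementQuot_le hβ hp (half_pos ht) hv
  rw [mul_div_cancel₀ _ two_ne_zero] at hbound
  set Φ := radialMeasure E (β * (p - 1)) {h | ‖h‖ ^ β < 1}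
  have hscale : ∀ x, ENNReal.ofReal t ^ p * (ENNReal.ofReal (‖fderiv ℝ v x‖ / (t / 2)) ^ p * Φ) =
      2 ^ p * Φ * ‖fderiv ℝ v x‖ₑ ^ p := fun x => by
    rw [← mul_assoc, ← ENNReal.mul_rpow_of_nonneg _ _ hp0, ← ENNReal.ofReal_mul ht.le,
      mul_right_comm, ← ENNReal.mul_rpow_of_nonneg _ _ hp0, ← ofReal_norm,
      ← ENNReal.ofReal_ofNat, ← ENNReal.ofReal_mul zero_le_two]
    congr 3
    field_simp
  refine (mul_le_mul_right hbound _).trans_eq ?_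
  rw [← lintegral_const_mul _ (by fun_prop), ← lintegral_const_mul _ (by fun_prop)]
  simp_rw [hscale]

end IncrementQuotient

section LowerBound

variable {E : Type*} [NormedAddCommGroup E] [InnerProductSpace ℝ E]

/-- The limit `⟪ξ, h⟫ / ‖h‖ ^ (1 + b)` of the rescaled difference quotients of a function with
gradient `ξ`. -/
noncomputable def innerQuot (b : ℝ) (ξ h : E) : ℝ :=
  ⟪ξ, h⟫_ℝ / ‖h‖ ^ (1 + b)

theorem innerQuot_smul_left (b a : ℝ) (ξ h : E) : innerQuot b (a • ξ) h = a * innerQuot b ξ h := by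
  rw [innerQuot, innerQuot, real_inner_smul_left, mul_div_assoc]

theorem innerQuot_smul_right (b : ℝ) {r : ℝ} (hr : 0 < r) (ξ h : E) :
    innerQuot b ξ (r • h) = r ^ (-b) * innerQuot b ξ h := by
  rw [innerQuot, innerQuot, real_inner_smul_right, norm_smul, Real.norm_of_nonneg hr.le,
    Real.mul_rpow hr.le (norm_nonneg h), Real.rpow_add hr, Real.rpow_one, Real.rpow_neg hr.le]
  field_simp

theorem innerQuot_map (b : ℝ) (e : E ≃ₗᵢ[ℝ] E) (ξ h : E) :
    innerQuot b (e ξ) (e h) = innerQuot b ξ h := by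
  rw [innerQuot, innerQuot, e.inner_map_map, e.norm_map]

theorem innerQuot_self (b : ℝ) {e : E} (he : ‖e‖ = 1) : innerQuot b e e = 1 := by
  simp [innerQuot, he]

theorem zero_notMem_lt_abs_innerQuot (b : ℝ) {t : ℝ} (ht : 0 ≤ t) (ξ : E) :
    (0 : E) ∉ {h | t < |innerQuot b ξ h|} := by
  simpa [innerQuot] using ht

theorem isOpen_lt_abs_innerQuot (b : ℝ) {t : ℝ} (ht : 0 ≤ t) (ξ : E) :
    IsOpen {h | t < |innerQuot b ξ h|} := by
  refine isOpen_iff_mem_nhds.2 fun h hh => ?_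
  have hh0 : h ≠ 0 := fun h0 => zero_notMem_lt_abs_innerQuot b ht ξ (h0 ▸ hh)
  have hcont : ContinuousAt (innerQuot b ξ) h :=
    (continuousAt_const.inner continuousAt_id).div
      (continuousAt_id.norm.rpow_const (.inl (norm_ne_zero_iff.2 hh0)))
      (Real.rpow_pos_of_pos (norm_pos_iff.2 hh0) _).ne'
  exact hcont.abs.eventually_const_lt hh

theorem continuous_gradient [CompleteSpace E] {v : E → ℝ} (hv : ContDiff ℝ 1 v) :
    Continuous (gradient v) :=
  (InnerProductSpace.toDual ℝ E).symm.continuous.comp (hv.continuous_fderiv one_ne_zero)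

theorem tendsto_incrementQuot [CompleteSpace E] {v : E → ℝ} (hv : Differentiable ℝ v)
    (b : ℝ) (x h : E) :
    Tendsto (fun n : ℕ => (1 / ((n : ℝ) + 1)) ^ b *
      incrementQuot b v (x, (1 / ((n : ℝ) + 1)) • h)) atTop (𝓝 (innerQuot b (gradient v x) h)) := by
  have hε : Tendsto (fun n : ℕ => 1 / ((n : ℝ) + 1)) atTop (𝓝[≠] 0) :=
    tendsto_nhdsWithin_iff.2 ⟨tendsto_one_div_add_atTop_nhds_zero_nat,
      Eventually.of_forall fun n => Nat.one_div_pos_of_nat.ne'⟩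
  have hslope := (((hv x).hasFDerivAt.hasLineDerivAt h).tendsto_slope_zero.comp hε).div_const
    (‖h‖ ^ (1 + b))
  rw [innerQuot, inner_gradient_left]
  refine hslope.congr fun n => ?_
  have hpos : 0 < 1 / ((n : ℝ) + 1) := Nat.one_div_pos_of_nat
  simp only [Function.comp_apply, incrementQuot, smul_eq_mul]
  rw [norm_smul, Real.norm_of_nonneg hpos.le, Real.mul_rpow hpos.le (norm_nonneg h),
    Real.rpow_add hpos, Real.rpow_one]
  have := Real.rpow_pos_of_pos hpos b
  field_simp

variable [FiniteDimensional ℝ E] [MeasurableSpace E] [BorelSpace E]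

theorem radialMeasure_one_lt_abs_innerQuot_pos {γ b : ℝ} (hb : b ≠ 0) {e : E} (he : ‖e‖ = 1) :
    0 < radialMeasure E γ {h | 1 < |innerQuot b e h|} := by
  refine radialMeasure_pos (isOpen_lt_abs_innerQuot b zero_le_one e)
    ⟨(2 : ℝ) ^ (-b⁻¹) • e, ?_⟩ (zero_notMem_lt_abs_innerQuot b zero_le_one e)
  rw [mem_ofPred_eq, innerQuot_smul_right b (by positivity), innerQuot_self b he, mul_one,
    ← Real.rpow_mul zero_le_two, neg_mul_neg, inv_mul_cancel₀ hb, Real.rpow_one]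
  norm_num

/-- A reflection carries `ξ` to `‖ξ‖ • e`, and a dilation absorbs the factor `‖ξ‖ / t`. -/
theorem ofReal_rpow_mul_radialMeasure_lt_abs_innerQuot {b p t : ℝ} (hb : b ≠ 0) (hp : 0 < p)
    (ht : 0 < t) (ξ : E) {e : E} (he : ‖e‖ = 1) :
    ENNReal.ofReal t ^ p * radialMeasure E (b * p) {h | t < |innerQuot b ξ h|} =
      ‖ξ‖ₑ ^ p * radialMeasure E (b * p) {h | 1 < |innerQuot b e h|} := by
  rcases eq_or_ne ξ 0 with rfl | hξ
  · simp [innerQuot, ht.not_gt, hp]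
  have hnorm : 0 < ‖ξ‖ := norm_pos_iff.2 hξ
  set σ := Submodule.reflection (ℝ ∙ (ξ - ‖ξ‖ • e))ᗮ
  have hσ : σ ξ = ‖ξ‖ • e := Submodule.reflection_sub (by simp [norm_smul, he])
  set a := ‖ξ‖ / t
  have ha : 0 < a := by positivity
  set r := a ^ (-b⁻¹)
  have hr : 0 < r := Real.rpow_pos_of_pos ha _
  have hrb : r ^ (-b) = a := by
    rw [← Real.rpow_mul ha.le, neg_mul_neg, inv_mul_cancel₀ hb, Real.rpow_one]
  have hset : {h | t < |innerQuot b ξ h|} = σ ⁻¹' ((r • ·) ⁻¹' {h | 1 < |innerQuot b e h|}) := by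
    ext h
    simp only [mem_preimage, mem_ofPred_eq]
    rw [← innerQuot_map b σ, hσ, innerQuot_smul_left, innerQuot_smul_right b hr, hrb, abs_mul,
      abs_mul, abs_of_pos ha, abs_of_pos hnorm, div_mul_eq_mul_div, one_lt_div ht]
  have hopen := (isOpen_lt_abs_innerQuot b zero_le_one e).preimage (continuous_const_smul r)
  rw [hset, (measurePreserving_radialMeasure σ).measure_preimage
    hopen.measurableSet.nullMeasurableSet, radialMeasure_preimage_smul hr, ← mul_assoc,
    ← neg_mul, Real.rpow_mul hr.le, hrb, ← ENNReal.ofReal_rpow_of_pos ha,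
    ← ENNReal.mul_rpow_of_nonneg _ _ hp.le, ← ENNReal.ofReal_mul ht.le,
    mul_div_cancel₀ _ ht.ne', ofReal_norm]

/-- If a cone `C` had finite measure, then by homogeneity `C ∩ ball 0 1` and `C ∩ ball 0 2` would
have the same measure. -/
theorem radialMeasure_zero_eq_top_of_cone {C : Set E} (hC : IsOpen C) (hne : C.Nonempty)
    (h0 : (0 : E) ∉ C) (hcone : ∀ r : ℝ, 0 < r → (r • ·) ⁻¹' C = C) :
    radialMeasure E 0 C = ⊤ := by
  by_contra hfin
  set shell : Set E := C ∩ (ball 0 2 \ closedBall 0 1)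
  have hdil : radialMeasure E 0 (C ∩ ball 0 2) = radialMeasure E 0 (C ∩ ball 0 1) := by
    have hpre : C ∩ ball 0 2 = ((2 : ℝ)⁻¹ • ·) ⁻¹' (C ∩ ball 0 1) := by
      rw [preimage_inter, hcone _ (by norm_num), preimage_smul₀ (by norm_num), inv_inv,
        smul_ball two_ne_zero]
      simp
    rw [hpre, radialMeasure_preimage_smul (by norm_num)]
    simp
  have hpos : 0 < radialMeasure E 0 shell := by
    refine radialMeasure_pos (hC.inter (isOpen_ball.sdiff isClosed_closedBall)) ?_
      fun h => h0 h.1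
    obtain ⟨h, hh⟩ := hne
    have hnorm : 0 < ‖h‖ := norm_pos_iff.2 fun h' => h0 (h' ▸ hh)
    have hr : 0 < 3 / 2 * ‖h‖⁻¹ := by positivity
    refine ⟨(3 / 2 * ‖h‖⁻¹) • h, ?_, ?_⟩
    · rwa [← hcone _ hr] at hh
    · have : ‖(3 / 2 * ‖h‖⁻¹) • h‖ = 3 / 2 := by
        rw [norm_smul, Real.norm_of_nonneg hr.le, inv_mul_cancel_right₀ hnorm.ne']
      simp only [Set.mem_sdiff, mem_ball_zero_iff, mem_closedBall_zero_iff, this]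
      norm_num
  have hdisj : Disjoint (C ∩ ball 0 1) shell :=
    disjoint_left.2 fun h hh hs => hs.2.2 (ball_subset_closedBall hh.2)
  have hle : radialMeasure E 0 (C ∩ ball 0 1) + radialMeasure E 0 shell ≤
      radialMeasure E 0 (C ∩ ball 0 1) := by
    rw [← measure_union' hdisj (hC.inter isOpen_ball).measurableSet, ← hdil]
    refine measure_mono (union_subset ?_ (inter_subset_inter_right _ sdiff_subset))
    exact inter_subset_inter_right _ (ball_subset_ball one_le_two)
  have hfin1 : radialMeasure E 0 (C ∩ ball 0 1) ≠ ⊤ :=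
    measure_ne_top_of_subset inter_subset_left hfin
  exact hle.not_gt (ENNReal.lt_add_right hfin1 hpos.ne')

theorem radialMeasure_zero_lt_abs_innerQuot {t : ℝ} (ht : 0 ≤ t) {ξ : E} (hξ : t < ‖ξ‖) :
    radialMeasure E 0 {h | t < |innerQuot 0 ξ h|} = ⊤ := by
  refine radialMeasure_zero_eq_top_of_cone (isOpen_lt_abs_innerQuot 0 ht ξ) ⟨ξ, ?_⟩
    (zero_notMem_lt_abs_innerQuot 0 ht ξ) fun r hr => ?_
  · rw [mem_ofPred_eq, innerQuot, real_inner_self_eq_norm_sq, add_zero, Real.rpow_one, pow_two,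
      mul_self_div_self, abs_norm]
    exact hξ
  · ext h
    simp only [mem_preimage, mem_ofPred_eq, innerQuot_smul_right 0 hr, neg_zero, Real.rpow_zero,
      one_mul]

theorem map_id_smul_prod_radialMeasure {α : Type*} [MeasurableSpace α] {μ : Measure α} [SFinite μ]
    {γ r : ℝ} (hr : 0 < r) :
    (μ.prod (radialMeasure E γ)).map (Prod.map id (r • ·)) =
      ENNReal.ofReal (r ^ (-γ)) • μ.prod (radialMeasure E γ) := by
  rw [← Measure.map_prod_map _ _ measurable_id (measurable_const_smul r), Measure.map_id,
    map_smul_radialMeasure hr, Measure.prod_smul_right]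

theorem weakLpNorm_dilation_le {α : Type*} [MeasurableSpace α] {μ : Measure α} [SFinite μ]
    {b p r : ℝ} (hp : 0 < p) (hr : 0 < r) {F : α × E → ℝ} (hF : Measurable F) :
    weakLpNorm (fun q => r ^ b * F (q.1, r • q.2)) p (μ.prod (radialMeasure E (b * p))) ≤
      weakLpNorm F p (μ.prod (radialMeasure E (b * p))) := by
  refine weakLpNorm_le_of_forall hp fun t ht => ?_
  have hrb : 0 < r ^ b := Real.rpow_pos_of_pos hr b
  have hset : {q : α × E | t < |r ^ b * F (q.1, r • q.2)|} =
      Prod.map id (r • ·) ⁻¹' {q | t / r ^ b < |F q|} := by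
    ext q
    simp only [mem_ofPred_eq, mem_preimage, Prod.map, id, abs_mul, abs_of_pos hrb,
      div_lt_iff₀' hrb]
  rw [hset, ← Measure.map_apply (by fun_prop) (measurableSet_lt measurable_const hF.abs),
    map_id_smul_prod_radialMeasure hr, Measure.smul_apply, smul_eq_mul, ← mul_assoc]
  refine le_trans (le_of_eq ?_) (ofReal_rpow_mul_le_weakLpNorm_rpow F hp (div_pos ht hrb))
  congr 1
  rw [ENNReal.ofReal_rpow_of_pos ht, ENNReal.ofReal_rpow_of_pos (by positivity),
    ← ENNReal.ofReal_mul (by positivity), Real.div_rpow ht.le hrb.le, Real.rpow_neg hr.le,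
    ← Real.rpow_mul hr.le, div_eq_mul_inv]

theorem weakLpNorm_innerQuot_gradient_le {b p : ℝ} (hp : 0 < p) {v : E → ℝ}
    (hv : ContDiff ℝ 1 v) :
    weakLpNorm (fun q : E × E => innerQuot b (gradient v q.1) q.2) p
        (volume.prod (radialMeasure E (b * p))) ≤
      weakLpNorm (incrementQuot b v) p (volume.prod (radialMeasure E (b * p))) :=
  weakLpNorm_le_of_ae_tendsto hp
    (fun _ => weakLpNorm_dilation_le hp Nat.one_div_pos_of_nat
      (measurable_incrementQuot b hv.continuous.measurable))
    (ae_of_all _ fun q => tendsto_incrementQuot (hv.differentiable one_ne_zero) b q.1 q.2)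

theorem measurable_innerQuot_gradient (b : ℝ) {v : E → ℝ} (hv : ContDiff ℝ 1 v) :
    Measurable fun q : E × E => innerQuot b (gradient v q.1) q.2 := by
  have := (continuous_gradient hv).measurable
  unfold innerQuot
  fun_prop

theorem lintegral_enorm_gradient_rpow_mul_le {b p : ℝ} (hb : b ≠ 0) (hp : 0 < p) {v : E → ℝ}
    (hv : ContDiff ℝ 1 v) {e : E} (he : ‖e‖ = 1) :
    (∫⁻ x, ‖gradient v x‖ₑ ^ p) * radialMeasure E (b * p) {h | 1 < |innerQuot b e h|} ≤
      weakLpNorm (incrementQuot b v) p (volume.prod (radialMeasure E (b * p))) ^ p := by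
  have hm := (continuous_gradient hv).enorm.measurable.pow_const p
  have hS : MeasurableSet {q : E × E | 1 < |innerQuot b (gradient v q.1) q.2|} :=
    measurableSet_lt measurable_const (measurable_innerQuot_gradient b hv).abs
  have hslice : ∀ x, ‖gradient v x‖ₑ ^ p * radialMeasure E (b * p) {h | 1 < |innerQuot b e h|} =
      radialMeasure E (b * p) {h | 1 < |innerQuot b (gradient v x) h|} := fun x => by
    rw [← ofReal_rpow_mul_radialMeasure_lt_abs_innerQuot hb hp one_pos _ he, ENNReal.ofReal_one,
      ENNReal.one_rpow, one_mul]
  have hweak := (ofReal_rpow_mul_le_weakLpNorm_rpow _ hp one_pos).trans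
    (ENNReal.rpow_le_rpow (weakLpNorm_innerQuot_gradient_le (b := b) hp hv) hp.le)
  rw [ENNReal.ofReal_one, ENNReal.one_rpow, one_mul, Measure.prod_apply hS] at hweak
  rw [← lintegral_mul_const _ hm, lintegral_congr hslice]
  exact hweak

theorem gradient_eq_zero_of_weakLpNorm_ne_top {p : ℝ} (hp : 0 < p) {v : E → ℝ}
    (hv : ContDiff ℝ 1 v)
    (hK : weakLpNorm (incrementQuot 0 v) p (volume.prod (radialMeasure E 0)) ≠ ⊤) :
    gradient v = 0 := by
  have hW : weakLpNorm (fun q : E × E => innerQuot 0 (gradient v q.1) q.2) p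
      (volume.prod (radialMeasure E 0)) ≠ ⊤ := by
    have := weakLpNorm_innerQuot_gradient_le (b := 0) hp hv
    rw [zero_mul] at this
    exact ne_top_of_le_ne_top hK this
  have hle : ∀ t : ℝ, 0 < t → ∀ᵐ x, ‖gradient v x‖ ≤ t := fun t ht => by
    have hfin : (volume.prod (radialMeasure E 0))
        {q : E × E | t < |innerQuot 0 (gradient v q.1) q.2|} ≠ ⊤ :=
      ne_top_of_le_ne_top (ENNReal.mul_ne_top (ENNReal.rpow_ne_top_of_nonneg hp.le hW)
        ENNReal.ofReal_ne_top) (measure_lt_le_weakLpNorm_rpow_mul _ hp ht)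
    have hS : MeasurableSet {q : E × E | t < |innerQuot 0 (gradient v q.1) q.2|} :=
      measurableSet_lt measurable_const (measurable_innerQuot_gradient 0 hv).abs
    filter_upwards [Measure.ae_measure_lt_top hS hfin] with x hx
    have htop : radialMeasure E 0 {h | t < |innerQuot 0 (gradient v x) h|} ≠ ⊤ := hx.ne
    by_contra! hlt
    exact htop (radialMeasure_zero_lt_abs_innerQuot ht.le hlt)
  have hae : gradient v =ᵐ[volume] 0 := by
    have hseq : ∀ᵐ x, ∀ n : ℕ, ‖gradient v x‖ ≤ 1 / ((n : ℝ) + 1) :=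
      ae_all_iff.2 fun n => hle _ Nat.one_div_pos_of_nat
    filter_upwards [hseq] with x hx
    exact norm_le_zero_iff.1 (ge_of_tendsto' tendsto_one_div_add_atTop_nhds_zero_nat hx)
  exact ((continuous_gradient hv).ae_eq_iff_eq volume continuous_zero).1 hae

end LowerBound

section EuclideanDifferenceQuotient

theorem measurePreserving_withDensity {α β : Type*} [MeasurableSpace α] [MeasurableSpace β]
    {μ : Measure α} {ν : Measure β} {f : α → β} (hf : MeasurePreserving f μ ν) {w : β → ℝ≥0∞}
    (hw : Measurable w) : MeasurePreserving f (μ.withDensity (w ∘ f)) (ν.withDensity w) := by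
  refine ⟨hf.measurable, Measure.ext fun s hs => ?_⟩
  rw [Measure.map_apply hf.measurable hs, withDensity_apply _ (hf.measurable hs),
    withDensity_apply _ hs]
  exact hf.setLIntegral_comp_preimage hs hw

theorem eLpNorm_ofReal_rpow {α F : Type*} [MeasurableSpace α] [NormedAddCommGroup F]
    (f : α → F) {p : ℝ} (hp : 0 < p) (μ : Measure α) :
    eLpNorm f (ENNReal.ofReal p) μ ^ p = ∫⁻ x, ‖f x‖ₑ ^ p ∂μ := by
  have := eLpNorm_nnreal_pow_eq_lintegral (μ := μ) (f := f) (Real.toNNReal_pos.2 hp).ne'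
  rwa [Real.coe_toNNReal p hp.le] at this

variable {N : ℕ}

local notation "𝔼" => EuclideanSpace ℝ (Fin N)

theorem measurableSet_offDiag : MeasurableSet {z : 𝔼 × 𝔼 | z.1 ≠ z.2} :=
  (measurableSet_eq_fun measurable_fst measurable_snd).compl

theorem measurePreserving_nuMeasure (γ : ℝ) :
    MeasurePreserving (fun q : 𝔼 × 𝔼 => (q.1, q.1 + q.2)) (volume.prod (radialMeasure 𝔼 γ))
      (nuMeasure N γ) := by
  have hpre : (fun q : 𝔼 × 𝔼 => (q.1, q.1 + q.2)) ⁻¹' {z | z.1 ≠ z.2} = univ ×ˢ {0}ᶜ := by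
    ext q; simp
  have hdensity : (fun z : 𝔼 × 𝔼 => ENNReal.ofReal (‖z.1 - z.2‖ ^ (γ - (N : ℝ)))) ∘
      (fun q : 𝔼 × 𝔼 => (q.1, q.1 + q.2)) =
        fun q => ENNReal.ofReal (‖q.2‖ ^ (γ - (N : ℝ))) := by
    ext q; simp
  have hmp := measurePreserving_withDensity
    ((measurePreserving_prod_add (volume : Measure 𝔼) volume).restrict_preimage
      measurableSet_offDiag)
    (w := fun z : 𝔼 × 𝔼 => ENNReal.ofReal (‖z.1 - z.2‖ ^ (γ - (N : ℝ)))) (by fun_prop)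
  rw [hpre, hdensity, ← Measure.prod_restrict, Measure.restrict_univ] at hmp
  rw [radialMeasure, finrank_euclideanSpace_fin, prod_withDensity_right (by fun_prop)]
  exact hmp

theorem measurePreserving_sub_diag_nuMeasure (γ : ℝ) (s : 𝔼) :
    MeasurePreserving (fun z : 𝔼 × 𝔼 => z - (s, s)) (nuMeasure N γ) (nuMeasure N γ) := by
  have hpre : (fun z : 𝔼 × 𝔼 => z - (s, s)) ⁻¹' {z | z.1 ≠ z.2} = {z | z.1 ≠ z.2} := by
    ext z; simp
  have hdensity : (fun z : 𝔼 × 𝔼 => ENNReal.ofReal (‖z.1 - z.2‖ ^ (γ - (N : ℝ)))) ∘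
      (fun z : 𝔼 × 𝔼 => z - (s, s)) =
        fun z => ENNReal.ofReal (‖z.1 - z.2‖ ^ (γ - (N : ℝ))) := by
    ext z; simp
  have hmp := measurePreserving_withDensity
    ((measurePreserving_sub_right ((volume : Measure 𝔼).prod volume) (s, s)).restrict_preimage
      measurableSet_offDiag)
    (w := fun z : 𝔼 × 𝔼 => ENNReal.ofReal (‖z.1 - z.2‖ ^ (γ - (N : ℝ)))) (by fun_prop)
  rwa [hpre, hdensity] at hmp

instance (γ : ℝ) : SFinite (nuMeasure N γ) := by
  unfold nuMeasure
  infer_instance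

theorem ae_nuMeasure_of_ae {γ : ℝ} {P : 𝔼 → Prop} (h : ∀ᵐ x, P x) :
    ∀ᵐ z ∂(nuMeasure N γ), P z.1 ∧ P z.2 := by
  have hac : nuMeasure N γ ≪ (volume : Measure 𝔼).prod volume :=
    (withDensity_absolutelyContinuous _ _).trans Measure.absolutelyContinuous_restrict
  refine hac.ae_le ?_
  filter_upwards [Measure.quasiMeasurePreserving_fst.ae h, Measure.quasiMeasurePreserving_snd.ae h]
    with z h1 h2 using ⟨h1, h2⟩

theorem measurable_diffQuot (b : ℝ) {v : 𝔼 → ℝ} (hv : Measurable v) :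
    Measurable (diffQuot b v) := by
  unfold diffQuot
  fun_prop

theorem weakLpNorm_diffQuot_congr_ae {p γ b : ℝ} {u v : 𝔼 → ℝ} (h : u =ᵐ[volume] v) :
    weakLpNorm (diffQuot b u) p (nuMeasure N γ) = weakLpNorm (diffQuot b v) p (nuMeasure N γ) := by
  refine weakLpNorm_congr_ae ?_
  filter_upwards [ae_nuMeasure_of_ae h] with z hz
  rw [diffQuot, diffQuot, hz.1, hz.2]

theorem weakLpNorm_diffQuot_eq (b p γ : ℝ) {v : 𝔼 → ℝ} (hv : Measurable v) :
    weakLpNorm (diffQuot b v) p (nuMeasure N γ) =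
      weakLpNorm (incrementQuot b v) p (volume.prod (radialMeasure 𝔼 γ)) := by
  have habs : ∀ q : 𝔼 × 𝔼, |diffQuot b v (q.1, q.1 + q.2)| = |incrementQuot b v q| := fun q => by
    rw [diffQuot, incrementQuot, abs_div, abs_div, abs_sub_comm, sub_add_cancel_left, norm_neg]
  rw [← weakLpNorm_comp_measurePreserving (measurePreserving_nuMeasure γ)
    (measurable_diffQuot b hv)]
  simp only [weakLpNorm, Function.comp_apply, habs]

theorem enorm_fderiv_eq_enorm_gradient {E : Type*} [NormedAddCommGroup E] [InnerProductSpace ℝ E]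
    [CompleteSpace E] (v : E → ℝ) (x : E) : ‖fderiv ℝ v x‖ₑ = ‖gradient v x‖ₑ :=
  ((InnerProductSpace.toDual ℝ E).symm.enorm_map _).symm

theorem exists_weakLpNorm_diffQuot_le_of_contDiff [Nontrivial 𝔼] {p γ : ℝ} (hp : 1 < p)
    (hγ : γ ≠ 0) :
    ∃ C : ℝ≥0, ∀ v : 𝔼 → ℝ, ContDiff ℝ 1 v →
      weakLpNorm (diffQuot (γ / p) v) p (nuMeasure N γ) ≤
        C * eLpNorm (gradient v) (ENNReal.ofReal p) volume := by
  have hp0 : 0 < p := one_pos.trans hp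
  have hβ : γ / p ≠ 0 := div_ne_zero hγ hp0.ne'
  set A := (2 : ℝ≥0∞) ^ p * radialMeasure 𝔼 (γ / p * (p - 1)) {h | ‖h‖ ^ (γ / p) < 1}
  have hA : A ^ p⁻¹ ≠ ⊤ := ENNReal.rpow_ne_top_of_nonneg (by positivity) <|
    ENNReal.mul_ne_top (ENNReal.rpow_ne_top_of_nonneg hp0.le ENNReal.ofNat_ne_top)
      (radialMeasure_norm_rpow_lt_one_ne_top hβ (by linarith))
  refine ⟨(A ^ p⁻¹).toNNReal, fun v hv => ?_⟩
  rw [ENNReal.coe_toNNReal hA, weakLpNorm_diffQuot_eq _ _ _ hv.continuous.measurable]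
  refine weakLpNorm_le_of_forall hp0 fun t ht => ?_
  have hbound := ofReal_rpow_mul_measure_lt_incrementQuot_le hβ hp ht hv
  rw [div_mul_cancel₀ γ hp0.ne'] at hbound
  rw [ENNReal.mul_rpow_of_nonneg _ _ hp0.le, ENNReal.rpow_inv_rpow hp0.ne',
    eLpNorm_ofReal_rpow _ hp0]
  simpa only [enorm_fderiv_eq_enorm_gradient] using hbound

theorem exists_eLpNorm_gradient_le_of_contDiff [Nontrivial 𝔼] {p : ℝ} (hp : 0 < p) (γ : ℝ) :
    ∃ C : ℝ≥0, ∀ v : 𝔼 → ℝ, ContDiff ℝ 1 v →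
      weakLpNorm (diffQuot (γ / p) v) p (nuMeasure N γ) ≠ ⊤ →
        eLpNorm (gradient v) (ENNReal.ofReal p) volume ≤
          C * weakLpNorm (diffQuot (γ / p) v) p (nuMeasure N γ) := by
  rcases eq_or_ne γ 0 with rfl | hγ
  · refine ⟨0, fun v hv hfin => ?_⟩
    rw [zero_div, weakLpNorm_diffQuot_eq _ _ _ hv.continuous.measurable] at hfin
    simp [gradient_eq_zero_of_weakLpNorm_ne_top hp hv hfin]
  obtain ⟨e, he⟩ := exists_norm_eq 𝔼 zero_le_one
  have hβ : γ / p ≠ 0 := div_ne_zero hγ hp.ne'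
  set c := radialMeasure 𝔼 γ {h | 1 < |innerQuot (γ / p) e h|}
  have hc : c ≠ 0 := (radialMeasure_one_lt_abs_innerQuot_pos hβ he).ne'
  have hC : c⁻¹ ^ p⁻¹ ≠ ⊤ :=
    ENNReal.rpow_ne_top_of_nonneg (by positivity) (ENNReal.inv_ne_top.2 hc)
  refine ⟨(c⁻¹ ^ p⁻¹).toNNReal, fun v hv hfin => ?_⟩
  rw [weakLpNorm_diffQuot_eq _ _ _ hv.continuous.measurable] at hfin ⊢
  have hbound := lintegral_enorm_gradient_rpow_mul_le hβ hp hv he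
  rw [div_mul_cancel₀ γ hp.ne'] at hbound
  rw [ENNReal.coe_toNNReal hC, ← ENNReal.rpow_le_rpow_iff hp, ENNReal.mul_rpow_of_nonneg _ _ hp.le,
    ENNReal.rpow_inv_rpow hp.ne', eLpNorm_ofReal_rpow _ hp, mul_comm, ← div_eq_mul_inv]
  exact (ENNReal.le_div_iff_mul_le (.inl hc)
    (.inr (ENNReal.rpow_ne_top_of_nonneg hp.le hfin))).2 hbound

/-- The gradient of a nonzero test function would vanish. -/
theorem not_exists_weakLpNorm_diffQuot_zero_le [Nontrivial 𝔼] {p : ℝ} (hp : 1 ≤ p) :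
    ¬ ∃ C : ℝ≥0, ∀ u : 𝔼 → ℝ, ContDiff ℝ ∞ u → HasCompactSupport u →
      weakLpNorm (diffQuot (0 / p) u) p (nuMeasure N 0) ≤
        C * eLpNorm (gradient u) (ENNReal.ofReal p) volume := by
  rintro ⟨C, hC⟩
  let φ : ContDiffBump (0 : 𝔼) := ⟨1, 2, one_pos, one_lt_two⟩
  have hφ : ContDiff ℝ 1 φ := φ.contDiff
  have hmem : MemLp (gradient φ) (ENNReal.ofReal p) volume :=
    (continuous_gradient hφ).memLp_of_hasCompactSupport
      ((φ.hasCompactSupport.fderiv ℝ).comp_left (map_zero (InnerProductSpace.toDual ℝ 𝔼).symm))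
  have hfin := ne_top_of_le_ne_top (ENNReal.mul_ne_top ENNReal.coe_ne_top hmem.2.ne)
    (hC φ φ.contDiff φ.hasCompactSupport)
  rw [zero_div, weakLpNorm_diffQuot_eq _ _ _ hφ.continuous.measurable] at hfin
  have hgrad := gradient_eq_zero_of_weakLpNorm_ne_top (by linarith) hφ hfin
  have hfderiv : ∀ x, fderiv ℝ φ x = 0 := fun x =>
    (InnerProductSpace.toDual ℝ 𝔼).symm.map_eq_zero_iff.1 (congrFun hgrad x)
  obtain ⟨x, hx⟩ := exists_norm_eq 𝔼 (zero_le_two (α := ℝ))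
  have hconst := is_const_of_fderiv_eq_zero (hφ.differentiable one_ne_zero) hfderiv 0 x
  rw [φ.one_of_mem_closedBall (mem_closedBall_self zero_le_one), φ.zero_of_le_dist] at hconst
  · exact one_ne_zero hconst
  · rw [dist_zero_right, hx]

end EuclideanDifferenceQuotient

section Mollify

variable {E : Type*} [NormedAddCommGroup E]

variable (E) in
/-- A sequence of bump functions concentrating at the origin. -/
noncomputable def shrinkingBump (n : ℕ) : ContDiffBump (0 : E) where
  rIn := 1 / ((n : ℝ) + 1)
  rOut := 2 * (1 / ((n : ℝ) + 1))
  rIn_pos := by positivity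
  rIn_lt_rOut := lt_two_mul_self (by positivity)

theorem tendsto_shrinkingBump_rOut : Tendsto (fun n => (shrinkingBump E n).rOut) atTop (𝓝 0) := by
  have h := (tendsto_one_div_add_atTop_nhds_zero_nat (𝕜 := ℝ)).const_mul 2
  rwa [mul_zero] at h

variable {F : Type*} [InnerProductSpace ℝ E] [FiniteDimensional ℝ E] [MeasurableSpace E]
  [BorelSpace E] [NormedAddCommGroup F] [NormedSpace ℝ F] (φ : ContDiffBump (0 : E))

/-- The probability measure whose density is the normalized bump function `φ`. -/
noncomputable def bumpMeasure : Measure E :=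
  volume.withDensity fun s => ENNReal.ofReal (φ.normed volume s)

/-- The mollification of `u`: its convolution with the normalized bump function `φ`. -/
noncomputable def mollify (u : E → F) : E → F :=
  φ.normed volume ⋆[ContinuousLinearMap.lsmul ℝ ℝ, volume] u

theorem bumpMeasure_absolutelyContinuous : bumpMeasure φ ≪ volume :=
  withDensity_absolutelyContinuous _ _

instance : IsProbabilityMeasure (bumpMeasure φ) where
  measure_univ := by
    rw [bumpMeasure, withDensity_apply _ .univ, Measure.restrict_univ,
      ← ofReal_integral_eq_lintegral_ofReal φ.integrable_normed
        (Eventually.of_forall φ.nonneg_normed), φ.integral_normed, ENNReal.ofReal_one]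

theorem mollify_apply (u : E → F) (x : E) : mollify φ u x = ∫ s, u (x - s) ∂bumpMeasure φ := by
  rw [bumpMeasure, integral_withDensity_eq_integral_toReal_smul
    φ.continuous_normed.measurable.ennreal_ofReal (by simp)]
  simp_rw [ENNReal.toReal_ofReal (φ.nonneg_normed _)]
  rfl

theorem integrable_comp_sub_bumpMeasure {u : E → F} (hu : LocallyIntegrable u) (x : E) :
    Integrable (fun s => u (x - s)) (bumpMeasure φ) := by
  rw [bumpMeasure, integrable_withDensity_iff_integrable_smul'
    φ.continuous_normed.measurable.ennreal_ofReal (by simp)]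
  simp_rw [ENNReal.toReal_ofReal (φ.nonneg_normed _)]
  exact φ.hasCompactSupport_normed.convolutionExists_left (ContinuousLinearMap.lsmul ℝ ℝ)
    φ.continuous_normed hu x

theorem contDiff_mollify {u : E → F} (hu : LocallyIntegrable u) {n : ℕ∞} :
    ContDiff ℝ n (mollify φ u) :=
  φ.hasCompactSupport_normed.contDiff_convolution_left _ φ.contDiff_normed hu

theorem mollify_congr_ae {u v : E → F} (h : u =ᵐ[volume] v) : mollify φ u = mollify φ v := by
  ext x
  rw [mollify_apply, mollify_apply]
  exact integral_congr_ae ((bumpMeasure_absolutelyContinuous φ).ae_le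
    ((quasiMeasurePreserving_sub_left volume x).ae_eq_comp h))

theorem enorm_mollify_rpow_le {g : E → F} (hg : AEStronglyMeasurable g volume) {p : ℝ}
    (hp : 1 ≤ p) (x : E) : ‖mollify φ g x‖ₑ ^ p ≤ ∫⁻ s, ‖g (x - s)‖ₑ ^ p ∂bumpMeasure φ := by
  have hp0 : 0 < p := one_pos.trans_le hp
  have hgx : AEStronglyMeasurable (fun s => g (x - s)) (bumpMeasure φ) :=
    (hg.comp_quasiMeasurePreserving (quasiMeasurePreserving_sub_left volume x)).mono_ac
      (bumpMeasure_absolutelyContinuous φ)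
  have hjensen := eLpNorm'_le_eLpNorm'_of_exponent_le one_pos hp (bumpMeasure φ) hgx
  simp only [eLpNorm', ENNReal.rpow_one, one_div, inv_one] at hjensen
  rw [ENNReal.le_rpow_inv_iff hp0] at hjensen
  rw [mollify_apply]
  exact (ENNReal.rpow_le_rpow (enorm_integral_le_lintegral_enorm _) hp0.le).trans hjensen

theorem eLpNorm_mollify_le {g : E → F} (hg : AEStronglyMeasurable g volume) {p : ℝ}
    (hp : 1 ≤ p) :
    eLpNorm (mollify φ g) (ENNReal.ofReal p) volume ≤ eLpNorm g (ENNReal.ofReal p) volume := by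
  have hp0 : 0 < p := one_pos.trans_le hp
  have hmeas : AEMeasurable (Function.uncurry fun x s : E => ‖g (x - s)‖ₑ ^ p)
      (volume.prod (bumpMeasure φ)) :=
    ((hg.comp_quasiMeasurePreserving
      (quasiMeasurePreserving_sub_of_right_invariant volume volume)).mono_ac
        (.prod .rfl (bumpMeasure_absolutelyContinuous φ))).enorm.pow_const p
  rw [← ENNReal.rpow_le_rpow_iff hp0, eLpNorm_ofReal_rpow _ hp0, eLpNorm_ofReal_rpow _ hp0]
  calc ∫⁻ x, ‖mollify φ g x‖ₑ ^ p ≤ ∫⁻ x, ∫⁻ s, ‖g (x - s)‖ₑ ^ p ∂bumpMeasure φ :=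
        lintegral_mono (enorm_mollify_rpow_le φ hg hp)
    _ = ∫⁻ s, (∫⁻ x, ‖g (x - s)‖ₑ ^ p) ∂bumpMeasure φ := lintegral_lintegral_swap hmeas
    _ = ∫⁻ x, ‖g x‖ₑ ^ p := by
        simp_rw [lintegral_sub_right_eq_self (fun x => ‖g x‖ₑ ^ p)]
        rw [lintegral_const, measure_univ, mul_one]

theorem fderiv_mollify_apply {u : E → ℝ} (hu : LocallyIntegrable u) (x v : E) :
    fderiv ℝ (mollify φ u) x v = ∫ y, fderiv ℝ (φ.normed volume) (x - y) v * u y := by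
  have hφ : ContDiff ℝ 1 (φ.normed (volume : Measure E)) := φ.contDiff_normed
  have hint : Integrable fun s => (ContinuousLinearMap.precompL E (ContinuousLinearMap.lsmul ℝ ℝ))
      (fderiv ℝ (φ.normed (volume : Measure E)) s) (u (x - s)) :=
    (φ.hasCompactSupport_normed.fderiv ℝ).convolutionExists_left _
      (hφ.continuous_fderiv one_ne_zero) hu x
  rw [mollify, (φ.hasCompactSupport_normed.hasFDerivAt_convolution_left
      (ContinuousLinearMap.lsmul ℝ ℝ) hφ hu x).fderiv, convolution_def,
    ContinuousLinearMap.integral_apply hint, ← integral_sub_left_eq_self _ volume x]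
  simp only [sub_sub_cancel]
  rfl

theorem ae_tendsto_mollify [CompleteSpace F] {g : E → F} (hg : LocallyIntegrable g) :
    ∀ᵐ x, Tendsto (fun n => mollify (shrinkingBump E n) g x) atTop (𝓝 (g x)) :=
  ContDiffBump.ae_convolution_tendsto_right_of_locallyIntegrable (K := 2)
    tendsto_shrinkingBump_rOut (Eventually.of_forall fun _ => le_rfl) hg

theorem convolution_comp_neg_apply_zero (v χ : E → ℝ) :
    (v ⋆[ContinuousLinearMap.lsmul ℝ ℝ, volume] fun x => χ (-x)) 0 = ∫ x, v x * χ x := by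
  simp [convolution_def]

theorem integral_mollify_mul {u χ : E → ℝ} (hu : LocallyIntegrable u) (hχ : Continuous χ)
    (hχc : HasCompactSupport χ) :
    ∫ x, mollify φ u x * χ x =
      mollify φ (u ⋆[ContinuousLinearMap.lsmul ℝ ℝ, volume] fun x => χ (-x)) 0 := by
  have hψ : Continuous fun x => χ (-x) := hχ.comp continuous_neg
  have hψc : HasCompactSupport fun x => χ (-x) := hχc.comp_homeomorph (Homeomorph.neg E)
  have hu_norm : LocallyIntegrable (‖u ·‖) := fun x =>
    (hu x).imp fun _ hs => ⟨hs.1, hs.2.norm⟩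
  rw [← convolution_comp_neg_apply_zero]
  refine convolution_assoc _ _ _ _ (fun a b c => by simp [mul_assoc])
    φ.continuous_normed.aestronglyMeasurable hu.aestronglyMeasurable hψ.aestronglyMeasurable
    (Eventually.of_forall
      (φ.hasCompactSupport_normed.convolutionExists_left _ φ.continuous_normed hu))
    (Eventually.of_forall (hψc.norm.convolutionExists_right _ hu_norm hψ.norm)) ?_
  exact φ.hasCompactSupport_normed.norm.convolutionExists_left _ φ.continuous_normed.norm
    (hψc.norm.continuous_convolution_right _ hu_norm hψ.norm).locallyIntegrable 0

theorem tendsto_integral_mollify_mul {u χ : E → ℝ} (hu : LocallyIntegrable u) (hχ : Continuous χ)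
    (hχc : HasCompactSupport χ) :
    Tendsto (fun n => ∫ x, mollify (shrinkingBump E n) u x * χ x) atTop
      (𝓝 (∫ x, u x * χ x)) := by
  simp_rw [integral_mollify_mul _ hu hχ hχc, ← convolution_comp_neg_apply_zero u χ]
  exact ContDiffBump.convolution_tendsto_right_of_continuous tendsto_shrinkingBump_rOut
    ((hχc.comp_homeomorph (Homeomorph.neg E)).continuous_convolution_right _ hu
      (hχ.comp continuous_neg)) 0

end Mollify

section MollifiedDifferenceQuotient

variable {N : ℕ}

local notation "𝔼" => EuclideanSpace ℝ (Fin N)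

theorem diffQuot_mollify (φ : ContDiffBump (0 : 𝔼)) {u : 𝔼 → ℝ} (hu : LocallyIntegrable u)
    (b : ℝ) (z : 𝔼 × 𝔼) :
    diffQuot b (mollify φ u) z = ∫ s, diffQuot b u (z - (s, s)) ∂bumpMeasure φ := by
  rw [diffQuot, mollify_apply, mollify_apply,
    ← integral_sub (integrable_comp_sub_bumpMeasure φ hu _)
      (integrable_comp_sub_bumpMeasure φ hu _), ← integral_div]
  simp only [diffQuot, Prod.fst_sub, Prod.snd_sub, sub_sub_sub_cancel_right]

theorem weakLpNorm_diffQuot_mollify_le (φ : ContDiffBump (0 : 𝔼)) {u : 𝔼 → ℝ}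
    (hu : LocallyIntegrable u) {p : ℝ} (hp : 1 < p) (b γ : ℝ) :
    weakLpNorm (diffQuot b (mollify φ u)) p (nuMeasure N γ) ≤
      ENNReal.ofReal (2 ^ p / (p - 1)) ^ (1 / p) *
        weakLpNorm (diffQuot b u) p (nuMeasure N γ) := by
  obtain ⟨v, hv, huv⟩ := hu.aestronglyMeasurable
  rw [mollify_congr_ae φ huv, weakLpNorm_diffQuot_congr_ae huv]
  refine weakLpNorm_le_of_enorm_le_lintegral (ρ := bumpMeasure φ) (T := fun s z => z - (s, s))
    hp (by fun_prop) (measurePreserving_sub_diag_nuMeasure γ)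
    (measurable_diffQuot b hv.measurable) fun z => ?_
  rw [diffQuot_mollify φ (hu.congr huv)]
  exact enorm_integral_le_lintegral_enorm _

theorem gradient_apply (v : 𝔼 → ℝ) (x : 𝔼) (i : Fin N) :
    gradient v x i = fderiv ℝ v x (EuclideanSpace.single i 1) := by
  rw [← InnerProductSpace.toDual_symm_apply (y := fderiv ℝ v x), real_inner_comm,
    EuclideanSpace.inner_single_left, map_one, one_mul, gradient]

theorem gradient_mollify (φ : ContDiffBump (0 : 𝔼)) {u : 𝔼 → ℝ} {g : 𝔼 → 𝔼}
    (hu : LocallyIntegrable u) (hg : HasWeakGradient u g) :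
    gradient (mollify φ u) = mollify φ g := by
  ext x i
  let k : 𝔼 → ℝ := φ.normed volume
  have hk : ContDiff ℝ ∞ k := φ.contDiff_normed
  have hfderiv (y : 𝔼) : fderiv ℝ (fun y => k (x - y)) y = -fderiv ℝ k (x - y) := by
    have h := ((hk.differentiable (by simp)) (x - y)).hasFDerivAt.comp y
      ((hasFDerivAt_id y).const_sub x)
    exact h.fderiv.trans (by ext; simp)
  have htest := hg.integral_eq (fun y => k (x - y))
    (hk.comp (contDiff_const.sub contDiff_id))
    (φ.hasCompactSupport_normed.comp_homeomorph (Homeomorph.subLeft x)) i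
  simp only [hfderiv, neg_apply, mul_neg, integral_neg, neg_inj] at htest
  have hint : Integrable fun y => k (x - y) • g y :=
    hg.locallyIntegrable.integrable_smul_left_of_hasCompactSupport
      (hk.continuous.comp (continuous_sub_left x))
      (φ.hasCompactSupport_normed.comp_homeomorph (Homeomorph.subLeft x))
  calc gradient (mollify φ u) x i
      = ∫ y, u y * fderiv ℝ k (x - y) (EuclideanSpace.single i 1) := by
        rw [gradient_apply, fderiv_mollify_apply φ hu]
        simp only [k, mul_comm]
    _ = ∫ y, (k (x - y) • g y) i := by
        rw [htest]
        simp only [PiLp.smul_apply, smul_eq_mul, mul_comm]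
    _ = mollify φ g x i := by
        rw [mollify, convolution_lsmul_swap]
        exact (EuclideanSpace.proj (𝕜 := ℝ) i).integral_comp_comm hint

end MollifiedDifferenceQuotient

section ConvexityDefect

variable {F : Type*} [NormedAddCommGroup F] [NormedSpace ℝ F] {p : ℝ}

/-- The gap in the midpoint convexity inequality for `‖·‖ ^ p` at the pair `z`, a measure of its
strict convexity. -/
noncomputable def convexityDefect (p : ℝ) (z : F × F) : ℝ :=
  (‖z.1‖ ^ p + ‖z.2‖ ^ p) / 2 - ‖(1 / 2 : ℝ) • (z.1 + z.2)‖ ^ p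

theorem convexityDefect_smul (p : ℝ) {r : ℝ} (hr : 0 ≤ r) (z : F × F) :
    convexityDefect p (r • z) = r ^ p * convexityDefect p z := by
  have hnorm (a : F) : ‖r • a‖ ^ p = r ^ p * ‖a‖ ^ p := by
    rw [norm_smul_of_nonneg hr, Real.mul_rpow hr (norm_nonneg a)]
  rw [convexityDefect, convexityDefect, Prod.smul_fst, Prod.smul_snd, ← smul_add, smul_comm,
    hnorm, hnorm, hnorm]
  ring

theorem convexityDefect_pos [StrictConvexSpace ℝ F] (hp : 1 < p) {z : F × F}
    (hz : z.1 ≠ z.2) : 0 < convexityDefect p z := by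
  have hp0 : 0 < p := one_pos.trans hp
  rw [convexityDefect, sub_pos]
  rcases eq_or_ne ‖z.1‖ ‖z.2‖ with heq | hne
  · calc ‖(1 / 2 : ℝ) • (z.1 + z.2)‖ ^ p < ‖z.1‖ ^ p :=
          Real.rpow_lt_rpow (norm_nonneg _) ((norm_midpoint_lt_iff heq).2 hz) hp0
      _ = (‖z.1‖ ^ p + ‖z.2‖ ^ p) / 2 := by rw [← heq, add_self_div_two]
  · have hconv := (strictConvexOn_rpow hp).2 (norm_nonneg z.1) (norm_nonneg z.2) hne
      one_half_pos one_half_pos (add_halves (1 : ℝ))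
    calc ‖(1 / 2 : ℝ) • (z.1 + z.2)‖ ^ p ≤ (1 / 2 * ‖z.1‖ + 1 / 2 * ‖z.2‖) ^ p := by
          rw [norm_smul_of_nonneg one_half_pos.le, ← mul_add]
          gcongr
          exact norm_add_le _ _
      _ < 1 / 2 * ‖z.1‖ ^ p + 1 / 2 * ‖z.2‖ ^ p := hconv
      _ = (‖z.1‖ ^ p + ‖z.2‖ ^ p) / 2 := by ring

theorem convexityDefect_nonneg [StrictConvexSpace ℝ F] (hp : 1 < p) (z : F × F) :
    0 ≤ convexityDefect p z := by
  rcases eq_or_ne z.1 z.2 with heq | hne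
  · rw [convexityDefect, heq, ← two_smul ℝ z.2, smul_smul, one_div_mul_cancel two_ne_zero,
      one_smul, add_self_div_two, sub_self]
  · exact (convexityDefect_pos hp hne).le

theorem continuous_convexityDefect (hp : 0 ≤ p) :
    Continuous (convexityDefect p : F × F → ℝ) := by
  unfold convexityDefect
  fun_prop (disch := exact fun _ => Or.inr hp)

variable [StrictConvexSpace ℝ F] [FiniteDimensional ℝ F]

theorem exists_norm_sub_rpow_le_of_mem_sphere (hp : 1 < p) {η : ℝ} (hη : 0 < η) :
    ∃ C : ℝ, 0 < C ∧ ∀ z ∈ sphere (0 : F × F) 1,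
      ‖z.1 - z.2‖ ^ p ≤ η * (‖z.1‖ ^ p + ‖z.2‖ ^ p) + C * convexityDefect p z := by
  have hp0 : 0 < p := one_pos.trans hp
  have hdist : Continuous fun z : F × F => ‖z.1 - z.2‖ ^ p :=
    (continuous_fst.sub continuous_snd).norm.rpow_const fun _ => Or.inr hp0.le
  have hK : IsCompact (sphere (0 : F × F) 1 ∩ {z | η ≤ ‖z.1 - z.2‖ ^ p}) :=
    (isCompact_sphere 0 1).inter_right (isClosed_le continuous_const hdist)
  obtain ⟨m, hm, hmK⟩ := hK.exists_forall_le' (continuous_convexityDefect hp0.le).continuousOn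
    (a := 0) fun z hz => convexityDefect_pos hp fun heq => by
      have : η ≤ ‖z.1 - z.2‖ ^ p := hz.2
      rw [heq, sub_self, norm_zero, Real.zero_rpow hp0.ne'] at this
      exact hη.not_ge this
  refine ⟨2 ^ p / m, by positivity, fun z hz => ?_⟩
  have hz1 : max ‖z.1‖ ‖z.2‖ = 1 := mem_sphere_zero_iff_norm.1 hz
  rcases le_or_gt η (‖z.1 - z.2‖ ^ p) with hfar | hnear
  · calc ‖z.1 - z.2‖ ^ p ≤ 2 ^ p := by
          gcongr
          linarith [norm_sub_le z.1 z.2, le_max_left ‖z.1‖ ‖z.2‖, le_max_right ‖z.1‖ ‖z.2‖]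
      _ = 2 ^ p / m * m := (div_mul_cancel₀ _ hm.ne').symm
      _ ≤ 2 ^ p / m * convexityDefect p z := by gcongr; exact hmK z ⟨hz, hfar⟩
      _ ≤ _ := le_add_of_nonneg_left (by positivity)
  · have hone : 1 ≤ ‖z.1‖ ^ p + ‖z.2‖ ^ p := by
      rcases max_choice ‖z.1‖ ‖z.2‖ with h | h <;> rw [h] at hz1 <;> rw [hz1, Real.one_rpow]
      · exact le_add_of_nonneg_right (by positivity)
      · exact le_add_of_nonneg_left (by positivity)
    calc ‖z.1 - z.2‖ ^ p ≤ η * (‖z.1‖ ^ p + ‖z.2‖ ^ p) :=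
          hnear.le.trans (le_mul_of_one_le_right hη.le hone)
      _ ≤ _ := le_add_of_nonneg_right (mul_nonneg (by positivity) (convexityDefect_nonneg hp z))

theorem exists_norm_sub_rpow_le (hp : 1 < p) {η : ℝ} (hη : 0 < η) :
    ∃ C : ℝ, 0 < C ∧ ∀ a b : F,
      ‖a - b‖ ^ p ≤ η * (‖a‖ ^ p + ‖b‖ ^ p) + C * convexityDefect p (a, b) := by
  obtain ⟨C, hC, hsphere⟩ := exists_norm_sub_rpow_le_of_mem_sphere (F := F) hp hη
  refine ⟨C, hC, fun a b => ?_⟩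
  have hp0 : p ≠ 0 := (one_pos.trans hp).ne'
  rcases eq_or_ne (a, b) 0 with h0 | h0
  · obtain ⟨rfl, rfl⟩ := Prod.mk_eq_zero.1 h0
    simp [convexityDefect, Real.zero_rpow hp0]
  set r := ‖(a, b)‖
  have hr : 0 < r := norm_pos_iff.2 h0
  have hscale (c : F) : ‖c‖ ^ p = r ^ p * ‖r⁻¹ • c‖ ^ p := by
    rw [← Real.mul_rpow hr.le (norm_nonneg _), ← norm_smul_of_nonneg hr.le, smul_inv_smul₀ hr.ne']
  have hz := hsphere (r⁻¹ • (a, b)) (mem_sphere_zero_iff_norm.2 (norm_smul_inv_norm h0))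
  simp only [Prod.smul_fst, Prod.smul_snd, ← smul_sub] at hz
  calc ‖a - b‖ ^ p = r ^ p * ‖r⁻¹ • (a - b)‖ ^ p := hscale _
    _ ≤ r ^ p * (η * (‖r⁻¹ • a‖ ^ p + ‖r⁻¹ • b‖ ^ p) + C * convexityDefect p (r⁻¹ • (a, b))) := by
        gcongr
    _ = η * (‖a‖ ^ p + ‖b‖ ^ p) + C * convexityDefect p (a, b) := by
        rw [hscale a, hscale b, ← smul_inv_smul₀ hr.ne' (a, b), convexityDefect_smul p hr.le,
          smul_inv_smul₀ hr.ne' (a, b)]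
        ring

end ConvexityDefect

section UniformConvexLp

variable {α F : Type*} [MeasurableSpace α] {μ : Measure α} [NormedAddCommGroup F]
  {q : ℝ≥0∞} [Fact (1 ≤ q)]

theorem norm_Lp_rpow_eq_integral (hq : q ≠ ⊤) (f : Lp F q μ) :
    ‖f‖ ^ q.toReal = ∫ x, ‖f x‖ ^ q.toReal ∂μ := by
  have hq0 : q ≠ 0 := (one_pos.trans_le Fact.out).ne'
  rw [Lp.norm_def, (Lp.memLp f).eLpNorm_eq_integral_rpow_norm hq0 hq,
    ENNReal.toReal_ofReal (by positivity),
    Real.rpow_inv_rpow (integral_nonneg fun x => by positivity) (ENNReal.toReal_pos hq0 hq).ne']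

variable [NormedSpace ℝ F] [StrictConvexSpace ℝ F] [FiniteDimensional ℝ F]

theorem exists_norm_sub_rpow_le_Lp (hq1 : 1 < q) (hq : q ≠ ⊤) {η : ℝ} (hη : 0 < η) :
    ∃ C : ℝ, 0 < C ∧ ∀ f g : Lp F q μ, ‖f - g‖ ^ q.toReal ≤
      η * (‖f‖ ^ q.toReal + ‖g‖ ^ q.toReal) + C * convexityDefect q.toReal (f, g) := by
  have hp : 1 < q.toReal := by
    rwa [← ENNReal.toReal_one, ENNReal.toReal_lt_toReal ENNReal.one_ne_top hq]
  obtain ⟨C, hC, hpointwise⟩ := exists_norm_sub_rpow_le (F := F) hp hη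
  refine ⟨C, hC, fun f g => ?_⟩
  have hint (h : Lp F q μ) : Integrable (fun x => ‖h x‖ ^ q.toReal) μ :=
    (Lp.memLp h).integrable_norm_rpow (one_pos.trans hq1).ne' hq
  have hsum : Integrable (fun x => ‖f x‖ ^ q.toReal + ‖g x‖ ^ q.toReal) μ := (hint f).add (hint g)
  have hdefect : Integrable (fun x => (‖f x‖ ^ q.toReal + ‖g x‖ ^ q.toReal) / 2 -
      ‖((1 / 2 : ℝ) • (f + g)) x‖ ^ q.toReal) μ := (hsum.div_const 2).sub (hint _)
  simp only [convexityDefect, norm_Lp_rpow_eq_integral hq]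
  rw [← integral_add (hint f) (hint g), ← integral_div, ← integral_sub (hsum.div_const 2) (hint _),
    ← integral_const_mul, ← integral_const_mul,
    ← integral_add (hsum.const_mul η) (hdefect.const_mul C)]
  refine integral_mono_ae (hint _) ((hsum.const_mul η).add (hdefect.const_mul C)) ?_
  filter_upwards [Lp.coeFn_sub f g, Lp.coeFn_add f g, Lp.coeFn_smul (1 / 2 : ℝ) (f + g)]
    with x hsub hadd hsmul
  simp only [hsub, hsmul, Pi.sub_apply, Pi.smul_apply, hadd, Pi.add_apply]
  exact hpointwise (f x) (g x)

theorem uniformConvexSpace_Lp (hq1 : 1 < q) (hq : q ≠ ⊤) : UniformConvexSpace (Lp F q μ) where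
  uniform_convex ε hε := by
    have hp : 1 ≤ q.toReal := by
      rw [← ENNReal.toReal_one]
      exact ENNReal.toReal_mono hq hq1.le
    obtain ⟨C, hC, hdefect⟩ := exists_norm_sub_rpow_le_Lp (μ := μ) (F := F) hq1 hq
      (η := ε ^ q.toReal / 4) (by positivity)
    refine ⟨ε ^ q.toReal / (C * q.toReal), by positivity, fun f hf g hg hfg => ?_⟩
    have hbernoulli : 1 + q.toReal * (‖f + g‖ / 2 - 1) ≤ (‖f + g‖ / 2) ^ q.toReal := by
      have h := one_add_mul_self_le_rpow_one_add
        (by linarith [norm_nonneg (f + g)] : -1 ≤ ‖f + g‖ / 2 - 1) hp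
      rwa [add_sub_cancel] at h
    have hε_le : ε ^ q.toReal ≤ ε ^ q.toReal / 2 + C * (1 - (‖f + g‖ / 2) ^ q.toReal) := calc
      ε ^ q.toReal ≤ ‖f - g‖ ^ q.toReal := by gcongr
      _ ≤ _ := hdefect f g
      _ = ε ^ q.toReal / 2 + C * (1 - (‖f + g‖ / 2) ^ q.toReal) := by
        rw [convexityDefect, hf, hg, Real.one_rpow, norm_smul_of_nonneg one_half_pos.le]
        ring_nf
    have hgap : ε ^ q.toReal / (C * q.toReal) ≤ 2 - ‖f + g‖ := by
      rw [div_le_iff₀ (by positivity)]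
      linarith [mul_le_mul_of_nonneg_left hbernoulli hC.le]
    linarith

end UniformConvexLp

section UniformConvexCompactness

variable {X : Type*} [NormedAddCommGroup X] [NormedSpace ℝ X] [UniformConvexSpace X]

variable (X) in
theorem exists_forall_norm_add_le_two_mul_sub {ε R : ℝ} (hε : 0 < ε) :
    ∃ δ > 0, ∀ r ≤ R, ∀ x y : X, ‖x‖ ≤ r → ‖y‖ ≤ r → ε ≤ ‖x - y‖ → ‖x + y‖ ≤ 2 * r - δ := by
  rcases le_or_gt R 0 with hR | hR
  · refine ⟨1, one_pos, fun r hr x y hx hy hxy => ?_⟩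
    linarith [norm_sub_le x y]
  obtain ⟨δ, hδ, hball⟩ := exists_forall_closed_ball_dist_add_le_two_sub X (div_pos hε hR)
  refine ⟨δ * (ε / 2), by positivity, fun r hr x y hx hy hxy => ?_⟩
  have hr_lower : ε / 2 ≤ r := by linarith [norm_sub_le x y]
  have hr0 : 0 < r := (half_pos hε).trans_le hr_lower
  have hunit {w : X} (hw : ‖w‖ ≤ r) : ‖r⁻¹ • w‖ ≤ 1 := by
    rwa [norm_smul_of_nonneg (inv_nonneg.2 hr0.le), inv_mul_le_one₀ hr0]
  have hsep : ε / R ≤ ‖r⁻¹ • x - r⁻¹ • y‖ := by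
    rw [← smul_sub, norm_smul_of_nonneg (inv_nonneg.2 hr0.le), ← div_eq_inv_mul]
    gcongr
  have hsum := hball (hunit hx) (hunit hy) hsep
  rw [← smul_add, norm_smul_of_nonneg (inv_nonneg.2 hr0.le), inv_mul_le_iff₀ hr0] at hsum
  nlinarith [mul_le_mul_of_nonneg_left hr_lower hδ.le]

theorem cauchySeq_of_le_norm_add {x : ℕ → X} {d : ℕ → ℝ} {D : ℝ} (hd : Tendsto d atTop (𝓝 D))
    (hx : Tendsto (‖x ·‖) atTop (𝓝 D)) (hadd : ∀ n, ∀ k ≥ n, ∀ l ≥ n, 2 * d n ≤ ‖x k + x l‖) :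
    CauchySeq x := by
  refine Metric.cauchySeq_iff.2 fun ε hε => ?_
  obtain ⟨δ, hδ, hconvex⟩ := exists_forall_norm_add_le_two_mul_sub X (R := D + 1) hε
  have hsmall : ∀ᶠ n in atTop, D - δ / 4 < d n ∧ ‖x n‖ < D + min 1 (δ / 4) :=
    (hd.eventually_const_lt (by linarith)).and
      (hx.eventually_lt_const (lt_add_of_pos_right D (by positivity)))
  obtain ⟨n, hn⟩ := eventually_atTop.1 hsmall
  refine ⟨n, fun k hk l hl => ?_⟩
  by_contra! hfar
  have hle : ‖x k + x l‖ ≤ 2 * (D + min 1 (δ / 4)) - δ :=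
    hconvex _ (by gcongr; exact min_le_left _ _) (x k) (x l) (hn k hk).2.le (hn l hl).2.le
      (by rwa [← dist_eq_norm])
  linarith [hadd n k hk l hl, (hn n le_rfl).1, min_le_right 1 (δ / 4)]

/-- Almost norm-minimizing points of `C n` form a Cauchy sequence: their midpoints stay in the
sets, so the norms of the midpoints cannot drop. -/
theorem nonempty_iInter_of_antitone_of_convex [CompleteSpace X] {C : ℕ → Set X}
    (hanti : Antitone C) (hconv : ∀ n, Convex ℝ (C n)) (hclosed : ∀ n, IsClosed (C n)) {R : ℝ}
    (hR : ∀ n, ∃ x ∈ C n, ‖x‖ ≤ R) : (⋂ n, C n).Nonempty := by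
  let d : ℕ → ℝ := fun n => infDist 0 (C n)
  have hd_le {n : ℕ} {x : X} (hx : x ∈ C n) : d n ≤ ‖x‖ := by
    simpa only [dist_zero_left] using infDist_le_dist_of_mem (x := 0) hx
  have hne (n : ℕ) : (C n).Nonempty := (hR n).imp fun _ h => h.1
  have hmono : Monotone d := fun m n h => infDist_le_infDist_of_subset (hanti h) (hne n)
  have hbdd : BddAbove (range d) := ⟨R, forall_mem_range.2 fun n =>
    let ⟨_, hx, hxR⟩ := hR n
    (hd_le hx).trans hxR⟩
  have hd : Tendsto d atTop (𝓝 (⨆ n, d n)) := tendsto_atTop_ciSup hmono hbdd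
  have hchoose (n : ℕ) : ∃ x ∈ C n, ‖x‖ < d n + 1 / ((n : ℝ) + 1) := by
    simpa only [dist_zero_left] using
      (infDist_lt_iff (hne n)).1 (lt_add_of_pos_right (d n) Nat.one_div_pos_of_nat)
  choose x hxC hx using hchoose
  have hd_add : Tendsto (fun n : ℕ => d n + 1 / ((n : ℝ) + 1)) atTop (𝓝 (⨆ n, d n)) := by
    simpa only [add_zero] using hd.add tendsto_one_div_add_atTop_nhds_zero_nat
  have hcauchy : CauchySeq x := by
    refine cauchySeq_of_le_norm_add hd (tendsto_of_tendsto_of_tendsto_of_le_of_le hd hd_add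
      (fun n => hd_le (hxC n)) fun n => (hx n).le) fun n k hk l hl => ?_
    have hmid := hd_le ((hconv n).midpoint_mem (hanti hk (hxC k)) (hanti hl (hxC l)))
    rw [midpoint_eq_smul_add, norm_smul_of_nonneg (by simp), invOf_eq_inv] at hmid
    linarith
  obtain ⟨w, hw⟩ := cauchySeq_tendsto_of_complete hcauchy
  exact ⟨w, mem_iInter.2 fun n => (hclosed n).mem_of_tendsto hw
    ((eventually_ge_atTop n).mono fun m hm => hanti hm (hxC m))⟩

theorem exists_forall_map_eq_of_tendsto [CompleteSpace X] {x : ℕ → X} {R : ℝ}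
    (hx : ∀ n, ‖x n‖ ≤ R) :
    ∃ w, ∀ (ℓ : StrongDual ℝ X) (a : ℝ), Tendsto (fun n => ℓ (x n)) atTop (𝓝 a) → ℓ w = a := by
  obtain ⟨w, hw⟩ := nonempty_iInter_of_antitone_of_convex
    (C := fun n => closedConvexHull ℝ (x '' Ici n))
    (fun m n h => closedConvexHull_min
      ((image_mono (Ici_subset_Ici.2 h)).trans subset_closedConvexHull)
      convex_closedConvexHull isClosed_closedConvexHull)
    (fun _ => convex_closedConvexHull) (fun _ => isClosed_closedConvexHull)
    (fun n => ⟨x n, subset_closedConvexHull (mem_image_of_mem x self_mem_Ici), hx n⟩)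
  refine ⟨w, fun ℓ a hlim => dist_le_zero.1 (le_of_forall_pos_le_add fun ε hε => ?_)⟩
  obtain ⟨n, hn⟩ := eventually_atTop.1 (hlim.eventually (closedBall_mem_nhds a hε))
  have hsub : closedConvexHull ℝ (x '' Ici n) ⊆ ℓ ⁻¹' closedBall a ε :=
    closedConvexHull_min (image_subset_iff.2 hn)
      ((convex_closedBall a ε).linear_preimage ℓ.toLinearMap)
      (isClosed_closedBall.preimage ℓ.continuous)
  simpa only [zero_add] using mem_closedBall.1 (hsub (mem_iInter.1 hw n))

end UniformConvexCompactness

theorem exists_memLp_forall_integral_eq_of_tendsto {α F G : Type*} [MeasurableSpace α]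
    {μ : Measure α} [NormedAddCommGroup F] [NormedSpace ℝ F] [StrictConvexSpace ℝ F]
    [FiniteDimensional ℝ F] [NormedAddCommGroup G] [NormedSpace ℝ G] {q r : ℝ≥0∞}
    [q.HolderConjugate r] (hq1 : 1 < q) (hq : q ≠ ⊤) {f : ℕ → α → F}
    (hf : ∀ n, AEStronglyMeasurable (f n) μ) {K : ℝ≥0} (hK : ∀ n, eLpNorm (f n) q μ ≤ K) :
    ∃ g, MemLp g q μ ∧ ∀ (B : F →L[ℝ] G →L[ℝ] ℝ) (ψ : α → G) (a : ℝ), MemLp ψ r μ →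
      Tendsto (fun n => ∫ x, B (f n x) (ψ x) ∂μ) atTop (𝓝 a) → ∫ x, B (g x) (ψ x) ∂μ = a := by
  have : Fact (1 ≤ q) := ⟨hq1.le⟩
  have : Fact (1 ≤ r) := ⟨ENNReal.HolderConjugate.one_le r q⟩
  have : UniformConvexSpace (Lp F q μ) := uniformConvexSpace_Lp hq1 hq
  have hfLp (n : ℕ) : MemLp (f n) q μ := ⟨hf n, (hK n).trans_lt ENNReal.coe_lt_top⟩
  have hbound (n : ℕ) : ‖(hfLp n).toLp‖ ≤ K := by
    rw [Lp.norm_toLp]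
    exact ENNReal.toReal_le_coe_of_le_coe (hK n)
  obtain ⟨g, hg⟩ := exists_forall_map_eq_of_tendsto hbound
  refine ⟨g, Lp.memLp g, fun B ψ a hψ hlim => ?_⟩
  have hpairing (h : Lp F q μ) :
      (B.lpPairing μ q r).flip hψ.toLp h = ∫ x, B (h x) (ψ x) ∂μ := by
    rw [ContinuousLinearMap.flip_apply, ContinuousLinearMap.lpPairing_eq_integral]
    refine integral_congr_ae ?_
    filter_upwards [hψ.coeFn_toLp] with x hx
    rw [hx]
  rw [← hpairing g]
  refine hg _ a (hlim.congr fun n => ?_)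
  rw [hpairing]
  refine integral_congr_ae ?_
  filter_upwards [(hfLp n).coeFn_toLp] with x hx
  rw [hx]

section WeakGradient

variable {N : ℕ}

local notation "𝔼" => EuclideanSpace ℝ (Fin N)

theorem integral_gradient_mul {v φ : 𝔼 → ℝ} (hv : ContDiff ℝ 1 v) (hφ : ContDiff ℝ 1 φ)
    (hφc : HasCompactSupport φ) (i : Fin N) :
    ∫ x, gradient v x i * φ x = -∫ x, v x * fderiv ℝ φ x (EuclideanSpace.single i 1) := by
  have hcont {w : 𝔼 → ℝ} (hw : ContDiff ℝ 1 w) :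
      Continuous fun x => fderiv ℝ w x (EuclideanSpace.single i 1) :=
    (hw.continuous_fderiv one_ne_zero).clm_apply continuous_const
  have hφ'c : HasCompactSupport fun x => fderiv ℝ φ x (EuclideanSpace.single i 1) :=
    hφc.fderiv_apply ℝ _
  simp_rw [gradient_apply]
  rw [integral_mul_fderiv_eq_neg_fderiv_mul_of_integrable, neg_neg]
  · exact ((hcont hv).mul hφ.continuous).integrable_of_hasCompactSupport hφc.mul_left
  · exact (hv.continuous.mul (hcont hφ)).integrable_of_hasCompactSupport hφ'c.mul_left
  · exact (hv.continuous.mul hφ.continuous).integrable_of_hasCompactSupport hφc.mul_left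
  · exact fun x _ => hv.differentiable one_ne_zero x
  · exact fun x _ => hφ.differentiable one_ne_zero x

/-- The bounded sequence of mollified gradients has a weak limit in `L^p`, and integration by parts
against the mollifications of `u` passes to the limit. -/
theorem memHomogeneousSobolev_of_eLpNorm_gradient_mollify_le {p : ℝ} (hp : 1 < p) {u : 𝔼 → ℝ}
    (hu : LocallyIntegrable u) {K : ℝ≥0} (hK : ∀ n, eLpNorm (gradient (mollify
      (shrinkingBump 𝔼 n) u)) (ENNReal.ofReal p) volume ≤ K) : MemHomogeneousSobolev p u := by
  have hq : 1 < ENNReal.ofReal p := ENNReal.one_lt_ofReal.2 hp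
  let r : ℝ≥0∞ := ENNReal.ofReal (Real.conjExponent p)
  have : (ENNReal.ofReal p).HolderConjugate r :=
    (Real.HolderConjugate.conjExponent hp).ennrealOfReal
  have hsmooth (n : ℕ) : ContDiff ℝ 1 (mollify (shrinkingBump 𝔼 n) u) :=
    contDiff_mollify (n := 1) _ hu
  obtain ⟨g, hgLp, hg⟩ := exists_memLp_forall_integral_eq_of_tendsto (G := ℝ) (r := r) hq
    ENNReal.ofReal_ne_top (fun n => (continuous_gradient (hsmooth n)).aestronglyMeasurable) hK
  refine ⟨hu, g, ⟨hgLp.locallyIntegrable hq.le, fun φ hφ hφc i => ?_⟩, hgLp⟩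
  have hφ1 : ContDiff ℝ 1 φ := hφ.of_le (by simp)
  have hlim : Tendsto (fun n => ∫ x, gradient (mollify (shrinkingBump 𝔼 n) u) x i * φ x) atTop
      (𝓝 (-∫ x, u x * fderiv ℝ φ x (EuclideanSpace.single i 1))) := by
    simp_rw [integral_gradient_mul (hsmooth _) hφ1 hφc]
    exact (tendsto_integral_mollify_mul hu
      ((hφ1.continuous_fderiv one_ne_zero).clm_apply continuous_const) (hφc.fderiv_apply ℝ _)).neg
  have hweak := hg ((ContinuousLinearMap.lsmul ℝ ℝ).comp (EuclideanSpace.proj i)) φ _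
    (hφ.continuous.memLp_of_hasCompactSupport hφc) hlim
  exact neg_eq_iff_eq_neg.1 hweak.symm

theorem eLpNorm_le_of_eLpNorm_gradient_mollify_le {q : ℝ≥0∞} {u : 𝔼 → ℝ}
    (hu : LocallyIntegrable u) {g : 𝔼 → 𝔼} (hg : HasWeakGradient u g) {B : ℝ≥0∞}
    (hB : ∀ n, eLpNorm (gradient (mollify (shrinkingBump 𝔼 n) u)) q volume ≤ B) :
    eLpNorm g q volume ≤ B := by
  simp_rw [gradient_mollify _ hu hg] at hB
  have hcont (n : ℕ) : Continuous (mollify (shrinkingBump 𝔼 n) g) :=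
    (contDiff_mollify (n := 0) _ hg.locallyIntegrable).continuous
  exact (Lp.eLpNorm_lim_le_liminf_eLpNorm (fun n => (hcont n).aestronglyMeasurable) g
    (ae_tendsto_mollify hg.locallyIntegrable)).trans
      (liminf_le_of_frequently_le' (Frequently.of_forall hB))

theorem ae_tendsto_diffQuot_mollify {u : 𝔼 → ℝ} (hu : LocallyIntegrable u) (b γ : ℝ) :
    ∀ᵐ z ∂(nuMeasure N γ), Tendsto (fun n => diffQuot b (mollify (shrinkingBump 𝔼 n) u) z) atTop
      (𝓝 (diffQuot b u z)) := by
  filter_upwards [ae_nuMeasure_of_ae (ae_tendsto_mollify hu)] with z hz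
  exact (hz.1.sub hz.2).div_const _

theorem exists_weakLpNorm_diffQuot_le_of_hasWeakGradient [Nontrivial 𝔼] {p γ : ℝ} (hp : 1 < p)
    (hγ : γ ≠ 0) :
    ∃ C : ℝ≥0, ∀ (u : 𝔼 → ℝ) (g : 𝔼 → 𝔼), LocallyIntegrable u → HasWeakGradient u g →
      weakLpNorm (diffQuot (γ / p) u) p (nuMeasure N γ) ≤
        C * eLpNorm g (ENNReal.ofReal p) volume := by
  obtain ⟨C, hC⟩ := exists_weakLpNorm_diffQuot_le_of_contDiff (N := N) hp hγ
  refine ⟨C, fun u g hu hg => weakLpNorm_le_of_ae_tendsto (one_pos.trans hp) (fun n => ?_)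
    (ae_tendsto_diffQuot_mollify hu _ γ)⟩
  refine (hC _ (contDiff_mollify (n := 1) _ hu)).trans ?_
  rw [gradient_mollify _ hu hg]
  gcongr
  exact eLpNorm_mollify_le _ hg.locallyIntegrable.aestronglyMeasurable hp.le

theorem exists_eLpNorm_gradient_mollify_le [Nontrivial 𝔼] {p : ℝ} (hp : 1 < p) (γ : ℝ) :
    ∃ C : ℝ≥0, ∀ (u : 𝔼 → ℝ) (φ : ContDiffBump (0 : 𝔼)), LocallyIntegrable u →
      weakLpNorm (diffQuot (γ / p) u) p (nuMeasure N γ) ≠ ⊤ →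
        eLpNorm (gradient (mollify φ u)) (ENNReal.ofReal p) volume ≤
          C * weakLpNorm (diffQuot (γ / p) u) p (nuMeasure N γ) := by
  obtain ⟨C, hC⟩ := exists_eLpNorm_gradient_le_of_contDiff (N := N) (one_pos.trans hp) γ
  let A : ℝ≥0 := (2 ^ p / (p - 1)).toNNReal ^ (1 / p)
  have hA : (A : ℝ≥0∞) = ENNReal.ofReal (2 ^ p / (p - 1)) ^ (1 / p) :=
    ENNReal.coe_rpow_of_nonneg _ (by positivity)
  refine ⟨C * A, fun u φ hu hfin => ?_⟩
  have hweak := weakLpNorm_diffQuot_mollify_le φ hu hp (γ / p) γ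
  rw [← hA] at hweak
  have hfin_mollify := ne_top_of_le_ne_top (ENNReal.mul_ne_top ENNReal.coe_ne_top hfin) hweak
  calc eLpNorm (gradient (mollify φ u)) (ENNReal.ofReal p) volume
      ≤ C * weakLpNorm (diffQuot (γ / p) (mollify φ u)) p (nuMeasure N γ) :=
        hC _ (contDiff_mollify (n := 1) φ hu) hfin_mollify
    _ ≤ C * (A * weakLpNorm (diffQuot (γ / p) u) p (nuMeasure N γ)) := by gcongr
    _ = _ := by rw [ENNReal.coe_mul, mul_assoc]

end WeakGradient

theorem theorem1p3 (N : ℕ) (hN : 1 ≤ N) (p : ℝ) (hp : 1 < p) (γ : ℝ) :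
    -- the weak-type bound on `C_c^∞` holds if and only if `γ ≠ 0`
    ((∃ C : ℝ≥0, ∀ u : EuclideanSpace ℝ (Fin N) → ℝ, ContDiff ℝ ∞ u → HasCompactSupport u →
        weakLpNorm (diffQuot (γ / p) u) p (nuMeasure N γ)
          ≤ (C : ℝ≥0∞) * eLpNorm (gradient u) (ENNReal.ofReal p) volume) ↔ γ ≠ 0) ∧
    -- in this case it extends to the homogeneous Sobolev space
    (γ ≠ 0 → ∃ C : ℝ≥0, ∀ u : EuclideanSpace ℝ (Fin N) → ℝ, MemHomogeneousSobolev p u →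
      ∀ g : EuclideanSpace ℝ (Fin N) → EuclideanSpace ℝ (Fin N), HasWeakGradient u g →
        weakLpNorm (diffQuot (γ / p) u) p (nuMeasure N γ)
          ≤ (C : ℝ≥0∞) * eLpNorm g (ENNReal.ofReal p) volume) ∧
    -- the converse, for every real `γ`
    (∃ C : ℝ≥0, ∀ u : EuclideanSpace ℝ (Fin N) → ℝ, LocallyIntegrable u volume →
      weakLpNorm (diffQuot (γ / p) u) p (nuMeasure N γ) < ⊤ →
        MemHomogeneousSobolev p u ∧
        ∀ g : EuclideanSpace ℝ (Fin N) → EuclideanSpace ℝ (Fin N), HasWeakGradient u g →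
          eLpNorm g (ENNReal.ofReal p) volume
            ≤ (C : ℝ≥0∞) * weakLpNorm (diffQuot (γ / p) u) p (nuMeasure N γ)) := by
  have : Nonempty (Fin N) := Fin.pos_iff_nonempty.1 hN
  have : Nontrivial (EuclideanSpace ℝ (Fin N)) := inferInstance
  refine ⟨⟨?_, fun hγ => ?_⟩, fun hγ => ?_, ?_⟩
  · rintro hbound rfl
    exact not_exists_weakLpNorm_diffQuot_zero_le hp.le hbound
  · obtain ⟨C, hC⟩ := exists_weakLpNorm_diffQuot_le_of_contDiff (N := N) hp hγ
    exact ⟨C, fun u hu _ => hC u (hu.of_le (by simp))⟩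
  · obtain ⟨C, hC⟩ := exists_weakLpNorm_diffQuot_le_of_hasWeakGradient (N := N) hp hγ
    exact ⟨C, fun u hu g hg => hC u g hu.1 hg⟩
  · obtain ⟨C, hC⟩ := exists_eLpNorm_gradient_mollify_le (N := N) hp γ
    refine ⟨C, fun u hu hfin => ⟨?_, fun g hg => ?_⟩⟩
    · refine memHomogeneousSobolev_of_eLpNorm_gradient_mollify_le hp hu
        (K := (C * weakLpNorm (diffQuot (γ / p) u) p (nuMeasure N γ)).toNNReal) fun n => ?_
      rw [ENNReal.coe_toNNReal (ENNReal.mul_ne_top ENNReal.coe_ne_top hfin.ne)]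
      exact hC u _ hu hfin.ne
    · exact eLpNorm_le_of_eLpNorm_gradient_mollify_le hu hg fun n => hC u _ hu hfin.ne
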